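/- **Setting.** Let $n,r,s$ be positive integers with $r,s\le n$ and let $\mu_0\in[1,n/r]$. The coherence of a subspace $U\subset\mathbb R^n$ is $\mu(U)=\frac{n}{\dim U}\max_{i}\|P_Ue_i\|_2^2$. The Kruskal rank of a matrix is the largest $k$, at most its number of columns, such that any $k$ of its columns are linearly independent. Let $\mathbb T(n,r,\mu_0,s)$ be the class of all tensors $\mathcal T=\sum_{l=1}^r a_l\circ b_l\circ c_l\in\mathbb R^{n\times n\times n}$ with factor matrices $A,B,C\in\mathbb R^{n\times r}$ such that (a) $A$ and $B$ have full column rank, (b) the column space of $A$ has coherence at most $\mu_0$, and (c) every $s\times r$ submatrix of $C$ has Kruskal rank at least $2$. **Tensor Sandwich.** For $S\subseteq\{1,\dots,n\}$ with $|S|=s$ and a number $m$, the algorithm does the following. 1. *Slices.* It completes each slice $\mathcal T_{:,:,k}$, $k\in S$, by adaptive matrix completion. It draws $m$ rows uniformly with replacement, giving a set $\Omega$, and goes through the columns $x$ in order, with $U$ the span of the columns fully observed so far. It observes $x_\Omega$. If $x_\Omega=y_\Omega$ for some $y\in U$, then $x$ is estimated by such a $y$; otherwise $x$ is fully observed, is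 added to those spanning $U$, and a new $\Omega$ is drawn. 2. *Factors $A,B$.* It draws independent uniform unit vectors $u,v\in\mathbb R^S$ and forms $T_u=\sum_{k\in S}u_k\mathcal T_{:,:,k}$ and $T_v=\sum_{k\in S}v_k\mathcal T_{:,:,k}$ from the completed slices. It computes an eigendecomposition $T_uT_v^\dagger=\hat A\Lambda\hat A^\dagger$ with $\hat A\in\mathbb R^{n\times r}$ of full column rank and $\Lambda$ diagonal, and sets $\hat B=(\hat A^\dagger T_u)^T$. 3. *Factor $C$.* A column-pivoted QR factorization of $(\hat A\odot\hat B)^T$ ($\odot$ is the Khatri–Rao product) selects $r$ pivot positions $K\subset\{1,\dots,n\}^2$. It observes the fibers $\mathcal T_{i,j,:}$, $(i,j)\in K$, obtains for each $k$ the row $\hat C_{k,:}$ as a least squares solution of $(\hat A\odot\hat B)_K\,c=(\mathcal T_{:,:,k})_K$, and outputs the tensor with factor matrices $\hat A,\hat B,\hat C$. **Theorem.** There is an absolute constant $C_1>0$ such that the following holds for all $n,r,s,\mu_0$ as above, all $\delta>0$, and all $S\subseteq\{1,\dots,n\}$ with $|S|=s$. There is an adaptive random sampling strategy with a reconstruction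 algorithm, not depending on the tensor, which for every $\mathcal T\in\mathbb T(n,r,\mu_0,s)$ always observes at most $$C_1\,s\,\mu_0\,n\,r\,\log^2(r^2/\delta)$$ entries of $\mathcal T$ and outputs exactly $\mathcal T$ with probability at least $1-s\delta$. When $\delta<1$, this algorithm can be taken to be Tensor Sandwich with slice set $S$ and a suitable row sample size $m$ (which does not depend on $\mathcal T$). -/

import Mathlib

open scoped BigOperators ENNReal

noncomputable section

/-! ### The class of tensors -/

/-- An `n × n × n` tensor of real numbers. -/
abbrev Tensor (n : ℕ) : Type := Fin n × Fin n × Fin n → ℝ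

/-- The Khatri-Rao product `A ⊙ B`; its rows are indexed by pairs. -/
def khatriRao {n r : ℕ} (A B : Matrix (Fin n) (Fin r) ℝ) :
    Matrix (Fin n × Fin n) (Fin r) ℝ :=
  fun p l => A p.1 l * B p.2 l

/-- The tensor `∑ₗ aₗ ∘ bₗ ∘ cₗ` with factor matrices `A`, `B`, `C`. -/
def cpTensor {n r : ℕ} (A B C : Matrix (Fin n) (Fin r) ℝ) : Tensor n :=
  fun p => ∑ l, A p.1 l * B p.2.1 l * C p.2.2 l

/-- The coherence `(n / dim U) * max_i ‖P_U e_i‖²` of a subspace `U` of `ℝⁿ`. -/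
def coherence {n : ℕ} (U : Submodule ℝ (EuclideanSpace ℝ (Fin n))) : ℝ :=
  ((n : ℝ) / (Module.finrank ℝ U : ℝ)) *
    ⨆ i : Fin n, ‖U.starProjection (EuclideanSpace.single i (1 : ℝ))‖ ^ 2

/-- The column space of a matrix, as a subspace of Euclidean space. -/
def columnSpace {n r : ℕ} (A : Matrix (Fin n) (Fin r) ℝ) :
    Submodule ℝ (EuclideanSpace ℝ (Fin n)) :=
  Submodule.span ℝ (Set.range fun l => WithLp.toLp 2 (A.col l))

/-- The Kruskal rank: the largest `k`, at most the number of columns, such that any `k` columns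
are linearly independent. -/
def kruskalRank {κ : Type} {r : ℕ} (M : Matrix κ (Fin r) ℝ) : ℕ :=
  sSup {k : ℕ | k ≤ r ∧ ∀ J : Finset (Fin r), J.card = k →
    LinearIndependent ℝ (fun l : J => M.col (l : Fin r))}

/-- The class `𝕋(n, r, μ₀, s)`. -/
def tensorClass (n r : ℕ) (μ₀ : ℝ) (s : ℕ) : Set (Tensor n) :=
  {T | ∃ A B C : Matrix (Fin n) (Fin r) ℝ, T = cpTensor A B C ∧
    LinearIndependent ℝ A.col ∧ LinearIndependent ℝ B.col ∧
    coherence (columnSpace A) ≤ μ₀ ∧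
    ∀ S : Finset (Fin n), S.card = s →
      2 ≤ kruskalRank (C.submatrix (fun k : S => (k : Fin n)) id)}

/-! ### Adaptive sampling -/

/-- A deterministic adaptive procedure that observes real entries at positions in `ι`, one at a
time, where each position may depend on all the values observed before, and that finally returns
an element of `α`. -/
inductive Sampler (ι α : Type) : Type
  | done (a : α) : Sampler ι α
  | observe (i : ι) (next : ℝ → Sampler ι α) : Sampler ι α

namespace Sampler

variable {ι ι' α β κ : Type}

/-- The value returned when the hidden array is `x`. -/
def output (x : ι → ℝ) : Sampler ι α → α
  | done a => a
  | observe i next => output x (next (x i))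

/-- The set of all positions observed when the hidden array is `x`. -/
def observed [DecidableEq ι] (x : ι → ℝ) : Sampler ι α → Finset ι
  | done _ => ∅
  | observe i next => insert i (observed x (next (x i)))

/-- Run a procedure, then continue depending on the value that it returned. -/
def bind (f : α → Sampler ι β) : Sampler ι α → Sampler ι β
  | done a => f a
  | observe i next => observe i fun y => bind f (next y)

/-- Run a procedure on the subarray given by an embedding of positions. -/
def reindex (f : ι → ι') : Sampler ι α → Sampler ι' α
  | done a => done a
  | observe i next => observe (f i) fun y => reindex f (next y)

/-- Run `p k` for the members `k` of a list one after the other, and record the results in a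
function of `k` (zero off the list). -/
def forEach [DecidableEq κ] [Zero β] (p : κ → Sampler ι β) : List κ → Sampler ι (κ → β)
  | [] => done 0
  | k :: l => (p k).bind fun b => (forEach p l).bind fun g => done (Function.update g k b)

/-- Observe all the positions of a list. -/
def observeList [DecidableEq ι] (l : List ι) : Sampler ι (ι → ℝ) :=
  forEach (fun i => observe i fun y => done y) l

end Sampler

/-- An adaptive random sampling strategy for `ℝ`-valued arrays on `ι`, with its reconstruction
algorithm: all the randomness is a seed `ω`, drawn independently of the array, and given the seed
the observations and the final answer are those of an adaptive procedure. -/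
structure AdaptiveAlgorithm (ι α : Type) where
  Seed : Type
  [measurableSpace : MeasurableSpace Seed]
  law : MeasureTheory.Measure Seed
  [isProbabilityMeasure : MeasureTheory.IsProbabilityMeasure law]
  run : Seed → Sampler ι α

attribute [instance] AdaptiveAlgorithm.measurableSpace AdaptiveAlgorithm.isProbabilityMeasure

/-! ### Slice completion: adaptive matrix completion -/

open Classical in
/-- Adaptive completion of an `n × n` matrix, column by column. `basis` holds the columns fully
observed so far, `U` is their span, and `Ω = draw j` is the current random set of rows, where `j`
is the number of columns fully observed so far (so that the set is redrawn after each of them).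
In each column `x` the entries in `Ω` are observed. If the residual of `x_Ω` with respect to `U_Ω`
vanishes, that is if `x_Ω` is the restriction of some `y ∈ U`, then `y` is the estimate of the
column; otherwise the column is fully observed and is added to the basis. -/
def completeColumns {n : ℕ} (draw : ℕ → Finset (Fin n)) :
    List (Fin n) → List (Fin n → ℝ) → Sampler (Fin n × Fin n) (Matrix (Fin n) (Fin n) ℝ)
  | [], _ => Sampler.done 0
  | t :: ts, basis =>
    (Sampler.observeList ((draw basis.length).toList.map fun i => (i, t))).bind fun z =>
      if h : ∃ y ∈ Submodule.span ℝ {b | b ∈ basis}, ∀ i ∈ draw basis.length, y i = z (i, t) then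
        (completeColumns draw ts basis).bind fun X =>
          Sampler.done (X.updateCol t h.choose)
      else
        (Sampler.observeList (Finset.univ.toList.map fun i => (i, t))).bind fun w =>
          (completeColumns draw ts ((fun i => w (i, t)) :: basis)).bind fun X =>
            Sampler.done (X.updateCol t fun i => w (i, t))

/-- The random choices of the completion of one matrix: `n + 1` samples (the initial one, and one
for each possible redraw), each of `m` rows, uniformly with replacement. -/
abbrev RowDraws (n m : ℕ) : Type := Fin (n + 1) → Fin m → Fin n

/-- Adaptive completion of an `n × n` matrix with row samples of size `m`. -/
def completeMatrix {n m : ℕ} (ω : RowDraws n m) :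
    Sampler (Fin n × Fin n) (Matrix (Fin n) (Fin n) ℝ) :=
  completeColumns (fun j => Finset.univ.image (ω (Fin.ofNat (n + 1) j))) (List.finRange n) []

/-! ### Numerical linear algebra -/

/-- The four Penrose equations. -/
def IsMoorePenrose {p q : ℕ} (M : Matrix (Fin p) (Fin q) ℝ) (X : Matrix (Fin q) (Fin p) ℝ) :
    Prop :=
  M * X * M = M ∧ X * M * X = X ∧ (M * X).transpose = M * X ∧ (X * M).transpose = X * M

/-- The Moore-Penrose inverse. -/
def pinv {p q : ℕ} (M : Matrix (Fin p) (Fin q) ℝ) : Matrix (Fin q) (Fin p) ℝ :=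
  Classical.epsilon (IsMoorePenrose M)

/-- `W = A Λ A†`, with `A` of full column rank and `Λ` diagonal. -/
def IsEigenDecomposition {n r : ℕ} (W : Matrix (Fin n) (Fin n) ℝ)
    (A : Matrix (Fin n) (Fin r) ℝ) (Λ : Fin r → ℝ) : Prop :=
  LinearIndependent ℝ A.col ∧ W = A * Matrix.diagonal Λ * pinv A

/-- The eigenvector matrix of an eigendecomposition of `W`. -/
def eigenvectorMatrix {n : ℕ} (r : ℕ) (W : Matrix (Fin n) (Fin n) ℝ) :
    Matrix (Fin n) (Fin r) ℝ :=
  Classical.epsilon fun A => ∃ Λ, IsEigenDecomposition W A Λ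

/-- `M Π = Q R` is a QR factorization with column pivoting: `Q` is orthogonal, `R` is upper
triangular, `Π` is the permutation that puts column `σ j` of `M` in place `j`, and at each step
`k` the chosen column has the largest residual norm among the remaining ones. -/
def IsPivotedQR {κ : Type} {r N : ℕ} (M : Matrix (Fin r) κ ℝ) (σ : Fin N ≃ κ)
    (Q : Matrix (Fin r) (Fin r) ℝ) (R : Matrix (Fin r) (Fin N) ℝ) : Prop :=
  Q ∈ Matrix.orthogonalGroup (Fin r) ℝ ∧ M.submatrix id σ = Q * R ∧
    (∀ (i : Fin r) (j : Fin N), (j : ℕ) < (i : ℕ) → R i j = 0) ∧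
    ∀ (k : Fin r) (d j : Fin N), (d : ℕ) = (k : ℕ) → d ≤ j →
      ∑ i ∈ Finset.Ici k, R i j ^ 2 ≤ R k d ^ 2

/-- The permutation of a QR factorization with column pivoting of an `r × n²` matrix. -/
def pivotOrder {n r : ℕ} (M : Matrix (Fin r) (Fin n × Fin n) ℝ) :
    Fin (n * n) ≃ Fin n × Fin n :=
  @Classical.epsilon _ ⟨finProdFinEquiv.symm⟩ fun σ => ∃ Q R, IsPivotedQR M σ Q R

/-- The fiber sampler: the mode-3 fibers at the first `r` pivots of `(A ⊙ B)ᵀ`. -/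
def fiberSample {n r : ℕ} (A B : Matrix (Fin n) (Fin r) ℝ) : Finset (Fin n × Fin n) :=
  (Finset.univ.filter fun q : Fin (n * n) => (q : ℕ) < r).map
    (pivotOrder (khatriRao A B).transpose).toEmbedding

/-- A solution of the censored least squares problem `M_K c = t_K`. -/
def censoredLeastSquares {κ : Type} {r : ℕ} (M : Matrix κ (Fin r) ℝ) (K : Finset κ) (t : κ → ℝ) :
    Fin r → ℝ :=
  Classical.epsilon fun c => ∀ c' : Fin r → ℝ,
    ∑ p ∈ K, (M.mulVec c p - t p) ^ 2 ≤ ∑ p ∈ K, (M.mulVec c' p - t p) ^ 2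

/-! ### Tensor Sandwich -/

/-- The unit sphere of `ℝ^S`. -/
abbrev UnitSphere {n : ℕ} (S : Finset (Fin n)) : Type :=
  Metric.sphere (0 : EuclideanSpace ℝ S) 1

/-- The uniform distribution on the unit sphere of `ℝ^S`. -/
def uniformSphere {n : ℕ} (S : Finset (Fin n)) : MeasureTheory.Measure (UnitSphere S) :=
  ProbabilityTheory.cond
    (MeasureTheory.volume : MeasureTheory.Measure (EuclideanSpace ℝ S)).toSphere Set.univ

theorem isProbabilityMeasure_uniformSphere {n : ℕ} {S : Finset (Fin n)} (hS : S.Nonempty) :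
    MeasureTheory.IsProbabilityMeasure (uniformSphere S) := by
  have : Nonempty S := hS.to_subtype
  have : Nontrivial (EuclideanSpace ℝ S) := by
    obtain ⟨k⟩ := this
    exact ⟨⟨0, EuclideanSpace.single k 1, fun h => by
      have := congrArg (fun v => v k) h
      simp at this⟩⟩
  refine ProbabilityTheory.cond_isProbabilityMeasure ?_
  rw [Ne, MeasureTheory.Measure.measure_univ_eq_zero]
  exact MeasureTheory.Measure.toSphere_ne_zero _

/-- The random choices of the algorithm: for each slice in `S` the row samples used to complete
it, and the two vectors `u`, `v` of the simultaneous diagonalization. -/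
abbrev SandwichSeed {n : ℕ} (S : Finset (Fin n)) (m : ℕ) : Type :=
  (S → RowDraws n m) × UnitSphere S × UnitSphere S

/-- All the row samples are uniform, `u` and `v` are uniform on the sphere, and all of them are
independent. -/
def sandwichLaw {n : ℕ} (S : Finset (Fin n)) (m : ℕ) :
    MeasureTheory.Measure (SandwichSeed S m) :=
  (ProbabilityTheory.uniformOn Set.univ).prod ((uniformSphere S).prod (uniformSphere S))

theorem isProbabilityMeasure_sandwichLaw {n : ℕ} {S : Finset (Fin n)} (hS : S.Nonempty) (m : ℕ) :
    MeasureTheory.IsProbabilityMeasure (sandwichLaw S m) := by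
  have := isProbabilityMeasure_uniformSphere hS
  have : Nonempty (Fin n) := ⟨hS.choose⟩
  have : MeasureTheory.IsProbabilityMeasure
      (ProbabilityTheory.uniformOn (Set.univ : Set (S → RowDraws n m))) :=
    ProbabilityTheory.isProbabilityMeasure_uniformOn Set.finite_univ Set.univ_nonempty
  unfold sandwichLaw
  infer_instance

/-- Tensor Sandwich, given the random choices. -/
def sandwichRun {n : ℕ} (r : ℕ) (S : Finset (Fin n)) {m : ℕ} (ω : SandwichSeed S m) :
    Sampler (Fin n × Fin n × Fin n) (Tensor n) :=
  -- complete the slices in `S`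
  (Sampler.forEach (fun k : S => (completeMatrix (ω.1 k)).reindex
    fun p => (p.1, p.2, (k : Fin n))) Finset.univ.toList).bind fun X =>
  -- simultaneous diagonalization
  let Tu : Matrix (Fin n) (Fin n) ℝ := ∑ k : S, (ω.2.1 : EuclideanSpace ℝ S) k • X k
  let Tv : Matrix (Fin n) (Fin n) ℝ := ∑ k : S, (ω.2.2 : EuclideanSpace ℝ S) k • X k
  let A : Matrix (Fin n) (Fin r) ℝ := eigenvectorMatrix r (Tu * pinv Tv)
  let B : Matrix (Fin n) (Fin r) ℝ := (pinv A * Tu).transpose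
  -- sample the fibers and solve the censored least squares problems
  let K : Finset (Fin n × Fin n) := fiberSample A B
  (Sampler.observeList ((K ×ˢ Finset.univ).toList.map
    fun q : (Fin n × Fin n) × Fin n => (q.1.1, q.1.2, q.2))).bind fun y =>
  let C : Matrix (Fin n) (Fin r) ℝ := fun k =>
    censoredLeastSquares (khatriRao A B) K fun p => y (p.1, p.2, k)
  Sampler.done (cpTensor A B C)

/-- The algorithm Tensor Sandwich for tensors of CP-rank `r`, which completes the slices in `S`
using row samples of size `m`. -/
def tensorSandwich {n : ℕ} (r : ℕ) (S : Finset (Fin n)) (hS : S.Nonempty) (m : ℕ) :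
    AdaptiveAlgorithm (Fin n × Fin n × Fin n) (Tensor n) where
  Seed := SandwichSeed S m
  law := sandwichLaw S m
  isProbabilityMeasure := isProbabilityMeasure_sandwichLaw hS m
  run := sandwichRun r S

end

noncomputable section

/-! ### Semantics of samplers -/

namespace Sampler

variable {ι ι' α β κ : Type}

/-! Every slice is `A diag(C k) Bᵀ`, so all its columns lie in the range of `A`, of dimension `r`. A
column is read in full only when it lies outside the current span, so this happens at most `r` times
per slice for every seed. This gives the deterministic bound `s(nm + rn) + rn` on the number of
observations. Completion is exact as soon as the samples of index at most `r` determine the vectors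
of the range of `A`.

The sampling estimate needs no concentration inequality. For a subspace `K` of the column space,
requiring that a random coordinate vanish lowers the dimension by at least `‖P_K eᵢ‖² / θ`, where `θ
= μ₀r/n` bounds `‖P eᵢ‖²` on the whole column space. Since `∑ ‖P_K eᵢ‖² = dim K`, each row
multiplies the mean dimension by at most `1 - 1/(μ₀r)`. Markov's inequality after `m` rows bounds
the failure probability of one sample by `r exp(-m/(μ₀r))`; a union bound covers `s` slices and `r +
1` samples each (`uniformOn_exists_not_injective_le`).

The rest succeeds almost surely. Pairwise independence of the columns of `C` restricted to `S` makes
the diagonals `d`, `e` of `T_u`, `T_v` nonzero with distinct ratios for almost all `u`, `v`. Then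
`T_u T_v† = A diag(d/e) A†` has simple nonzero spectrum on its range, so `Â` is `A` up to order and
scaling, and `B̂` absorbs the inverse change (`exists_factors_of_diagonalization`). Every slice,
inside `S` or not, becomes `Â diag(c) B̂ᵀ`. Pivoted QR selects rows of the Khatri–Rao product with
trivial common kernel, so least squares recovers `c` exactly. -/

theorem output_bind (x : ι → ℝ) (f : α → Sampler ι β) (p : Sampler ι α) :
    (p.bind f).output x = (f (p.output x)).output x := by
  induction p with
  | done a => rfl
  | observe i next ih => exact ih (x i)

theorem observed_bind [DecidableEq ι] (x : ι → ℝ) (f : α → Sampler ι β) (p : Sampler ι α) :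
    (p.bind f).observed x = p.observed x ∪ (f (p.output x)).observed x := by
  induction p with
  | done a => simp [bind, observed, output]
  | observe i next ih => simp [bind, observed, output, ih, Finset.insert_union]

theorem output_reindex (f : ι → ι') (x : ι' → ℝ) (p : Sampler ι α) :
    (p.reindex f).output x = p.output (x ∘ f) := by
  induction p with
  | done a => rfl
  | observe i next ih => exact ih (x (f i))

theorem observed_reindex [DecidableEq ι] [DecidableEq ι'] (f : ι → ι') (x : ι' → ℝ)
    (p : Sampler ι α) :
    (p.reindex f).observed x = (p.observed (x ∘ f)).image f := by
  induction p with
  | done a => simp [reindex, observed]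
  | observe i next ih => simp [reindex, observed, ih, Finset.image_insert]

theorem output_forEach_of_mem [DecidableEq κ] [Zero β] (x : ι → ℝ) (p : κ → Sampler ι β)
    {l : List κ} {k : κ} (hk : k ∈ l) : (forEach p l).output x k = (p k).output x := by
  induction l with
  | nil => simp at hk
  | cons a l ih =>
    simp only [forEach, output_bind, output]
    by_cases h : k = a
    · subst h; simp
    · rw [Function.update_of_ne h]
      exact ih ((List.mem_cons.mp hk).resolve_left h)

theorem card_observed_forEach_le [DecidableEq ι] [DecidableEq κ] [Zero β] (x : ι → ℝ)
    (p : κ → Sampler ι β) {N : ℕ} (l : List κ) (hp : ∀ k, ((p k).observed x).card ≤ N) :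
    ((forEach p l).observed x).card ≤ l.length * N := by
  induction l with
  | nil => simp [forEach, observed]
  | cons a l ih =>
    simp only [forEach, observed_bind, observed, Finset.union_empty, List.length_cons]
    refine (Finset.card_union_le _ _).trans ?_
    have := hp a
    linarith

theorem output_observeList_of_mem [DecidableEq ι] (x : ι → ℝ) {l : List ι} {i : ι}
    (hi : i ∈ l) : (observeList l).output x i = x i := by
  rw [observeList, output_forEach_of_mem x _ hi]; rfl

theorem card_observed_observeList_le [DecidableEq ι] (x : ι → ℝ) (l : List ι) :
    ((observeList l).observed x).card ≤ l.length := by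
  refine (card_observed_forEach_le x _ (N := 1) l fun k => ?_).trans_eq (mul_one _)
  simp [observed]

end Sampler

/-! ### Adaptive matrix completion -/

section Completion

variable {n : ℕ}

theorem span_setOf_mem_cons (w : Fin n → ℝ) (basis : List (Fin n → ℝ)) :
    Submodule.span ℝ {b | b ∈ w :: basis} =
      Submodule.span ℝ {w} ⊔ Submodule.span ℝ {b | b ∈ basis} := by
  rw [← Submodule.span_union]
  congr 1
  ext b
  simp

/-- Preserves the invariant that the recorded columns are independent, encoded as length at most the
dimension of their span. -/
theorem finrank_span_cons_of_notMem {w : Fin n → ℝ} {basis : List (Fin n → ℝ)}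
    (hw : w ∉ Submodule.span ℝ {b | b ∈ basis})
    (hb : basis.length ≤ Module.finrank ℝ (Submodule.span ℝ {b | b ∈ basis})) :
    (w :: basis).length ≤ Module.finrank ℝ (Submodule.span ℝ {b | b ∈ w :: basis}) := by
  have hlt : Submodule.span ℝ {b | b ∈ basis} < Submodule.span ℝ {b | b ∈ w :: basis} := by
    rw [span_setOf_mem_cons]
    refine lt_of_le_of_ne le_sup_right fun h => hw ?_
    rw [h]
    exact Submodule.mem_sup_left (Submodule.mem_span_singleton_self w)
  have := Submodule.finrank_lt_finrank_of_lt hlt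
  simp only [List.length_cons]
  omega

/-- Whatever the row samples are, at most `dim V` columns are fully observed if all the columns
lie in `V`. -/
theorem card_observed_completeColumns_le {draw : ℕ → Finset (Fin n)} {m : ℕ}
    (hdraw : ∀ j, (draw j).card ≤ m) {x : Fin n × Fin n → ℝ} {V : Submodule ℝ (Fin n → ℝ)}
    (hx : ∀ t, (fun i => x (i, t)) ∈ V) (ts : List (Fin n)) (basis : List (Fin n → ℝ))
    (hV : Submodule.span ℝ {b | b ∈ basis} ≤ V)
    (hb : basis.length ≤ Module.finrank ℝ (Submodule.span ℝ {b | b ∈ basis})) :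
    ((completeColumns draw ts basis).observed x).card + basis.length * n ≤
      ts.length * m + Module.finrank ℝ V * n := by
  -- The term `basis.length * n` is a potential: a full column costs `n` observations and raises it
  -- by `n`, and it can never exceed `dim V * n`.
  induction ts generalizing basis with
  | nil =>
    have : basis.length ≤ Module.finrank ℝ V := hb.trans (Submodule.finrank_mono hV)
    simpa [completeColumns, Sampler.observed] using Nat.mul_le_mul_right n this
  | cons t ts ih =>
    have hz : ∀ i ∈ draw basis.length, (Sampler.observeList
        ((draw basis.length).toList.map fun i => (i, t))).output x (i, t) = x (i, t) :=
      fun i hi => Sampler.output_observeList_of_mem _ (by simpa using hi)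
    have h1 : ((Sampler.observeList
        ((draw basis.length).toList.map fun i => (i, t))).observed x).card ≤ m :=
      (Sampler.card_observed_observeList_le _ _).trans (by simpa using hdraw _)
    rw [completeColumns, Sampler.observed_bind]
    refine (Nat.add_le_add_right (Finset.card_union_le _ _) _).trans ?_
    rw [List.length_cons]
    split_ifs with h
    · rw [Sampler.observed_bind]
      simp only [Sampler.observed, Finset.union_empty]
      have := ih basis hV hb
      linarith
    · rw [Sampler.observed_bind]
      have hw : (fun i => (Sampler.observeList
          (Finset.univ.toList.map fun i => (i, t))).output x (i, t)) = fun i => x (i, t) := by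
        ext i
        exact Sampler.output_observeList_of_mem _ (by simp)
      have h2 : ((Sampler.observeList
          (Finset.univ.toList.map fun i : Fin n => (i, t))).observed x).card ≤ n :=
        (Sampler.card_observed_observeList_le _ _).trans (by simp)
      rw [hw, Sampler.observed_bind]
      simp only [Sampler.observed, Finset.union_empty]
      -- A column in the span would itself pass the residual test, so a failed test certifies a new
      -- direction even when the sample is bad.
      have hnot : (fun i => x (i, t)) ∉ Submodule.span ℝ {b | b ∈ basis} := fun hmem =>
        h ⟨_, hmem, fun i hi => (hz i hi).symm⟩
      have := ih ((fun i => x (i, t)) :: basis) (by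
        rw [span_setOf_mem_cons]
        exact sup_le ((Submodule.span_singleton_le_iff_mem _ _).mpr (hx t)) hV)
        (finrank_span_cons_of_notMem hnot hb)
      have h3 := Finset.card_union_le ((Sampler.observeList
          (Finset.univ.toList.map fun i : Fin n => (i, t))).observed x)
          ((completeColumns draw ts ((fun i => x (i, t)) :: basis)).observed x)
      rw [List.length_cons] at this
      linarith

/-- The completion is exact if every row sample determines the vectors of `V`. -/
theorem output_completeColumns {draw : ℕ → Finset (Fin n)} {x : Fin n × Fin n → ℝ}
    {V : Submodule ℝ (Fin n → ℝ)} (hx : ∀ t, (fun i => x (i, t)) ∈ V)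
    (hdraw : ∀ j ≤ Module.finrank ℝ V, ∀ z ∈ V, (∀ i ∈ draw j, z i = 0) → z = 0)
    (ts : List (Fin n)) (basis : List (Fin n → ℝ))
    (hV : Submodule.span ℝ {b | b ∈ basis} ≤ V)
    (hb : basis.length ≤ Module.finrank ℝ (Submodule.span ℝ {b | b ∈ basis}))
    {t : Fin n} (ht : t ∈ ts) (i : Fin n) :
    (completeColumns draw ts basis).output x i t = x (i, t) := by
  induction ts generalizing basis with
  | nil => simp at ht
  | cons a ts ih =>
    have hz : ∀ i ∈ draw basis.length, (Sampler.observeList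
        ((draw basis.length).toList.map fun i => (i, a))).output x (i, a) = x (i, a) :=
      fun i hi => Sampler.output_observeList_of_mem _ (by simpa using hi)
    rw [completeColumns, Sampler.output_bind]
    split_ifs with h
    · simp only [Sampler.output_bind, Sampler.output]
      by_cases hta : t = a
      · subst hta
        rw [Matrix.updateCol_self]
        obtain ⟨hy, hyz⟩ := h.choose_spec
        have := hdraw basis.length (hb.trans (Submodule.finrank_mono hV))
          (h.choose - fun i => x (i, t)) (V.sub_mem (hV hy) (hx t)) fun i hi => by
            rw [Pi.sub_apply, hyz i hi, hz i hi, sub_self]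
        simpa [sub_eq_zero] using congrFun this i
      · rw [Matrix.updateCol_ne hta]
        exact ih basis hV hb ((List.mem_cons.mp ht).resolve_left hta)
    · have hw : (fun i => (Sampler.observeList
          (Finset.univ.toList.map fun i => (i, a))).output x (i, a)) = fun i => x (i, a) := by
        ext i
        exact Sampler.output_observeList_of_mem _ (by simp)
      simp only [Sampler.output_bind, Sampler.output]
      rw [hw]
      by_cases hta : t = a
      · subst hta
        rw [Matrix.updateCol_self]
      · rw [Matrix.updateCol_ne hta]
        have hnot : (fun i => x (i, a)) ∉ Submodule.span ℝ {b | b ∈ basis} := fun hmem =>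
          h ⟨_, hmem, fun i hi => (hz i hi).symm⟩
        refine ih ((fun i => x (i, a)) :: basis) ?_ (finrank_span_cons_of_notMem hnot hb)
          ((List.mem_cons.mp ht).resolve_left hta)
        rw [span_setOf_mem_cons]
        exact sup_le ((Submodule.span_singleton_le_iff_mem _ _).mpr (hx a)) hV

theorem card_observed_completeMatrix_le {m : ℕ} (ω : RowDraws n m) {x : Fin n × Fin n → ℝ}
    {V : Submodule ℝ (Fin n → ℝ)} (hx : ∀ t, (fun i => x (i, t)) ∈ V) :
    ((completeMatrix ω).observed x).card ≤ n * m + Module.finrank ℝ V * n := by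
  have := card_observed_completeColumns_le (m := m)
    (draw := fun j => Finset.univ.image (ω (Fin.ofNat (n + 1) j)))
    (fun j => Finset.card_image_le.trans (by simp)) hx (List.finRange n) [] (by simp) (by simp)
  simpa [completeMatrix] using this

theorem output_completeMatrix {m : ℕ} {ω : RowDraws n m} {x : Fin n × Fin n → ℝ}
    {V : Submodule ℝ (Fin n → ℝ)} (hx : ∀ t, (fun i => x (i, t)) ∈ V)
    (hω : ∀ j : Fin (n + 1), (j : ℕ) ≤ Module.finrank ℝ V →
      ∀ z ∈ V, (∀ a, z (ω j a) = 0) → z = 0) :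
    (completeMatrix ω).output x = fun i t => x (i, t) := by
  funext i t
  refine output_completeColumns hx (fun j hj z hz h => ?_) _ [] (by simp) (by simp)
    (List.mem_finRange t) i
  have hVn : Module.finrank ℝ V ≤ n := by
    simpa using Submodule.finrank_le V
  refine hω _ ?_ z hz fun a => h _ (Finset.mem_image_of_mem _ (Finset.mem_univ a))
  -- The index in `Fin (n + 1)` does not wrap around, since `j ≤ dim V ≤ n`.
  rwa [Fin.val_ofNat, Nat.mod_eq_of_lt (by omega)]

end Completion

/-! ### Random rows determine a coherent subspace -/

section RowSampling

variable {n : ℕ}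

/-- The trace of an orthogonal projection, computed in the standard basis, equals its rank. -/
theorem sum_norm_sq_starProjection_single (K : Submodule ℝ (EuclideanSpace ℝ (Fin n))) :
    ∑ i, ‖K.starProjection (EuclideanSpace.single i (1 : ℝ))‖ ^ 2 = Module.finrank ℝ K := by
  have hproj : LinearMap.IsProj K (K.starProjection : EuclideanSpace ℝ (Fin n) →ₗ[ℝ] _) :=
    ⟨fun x => K.starProjection_apply_mem x, fun x hx => K.starProjection_eq_self_iff.mpr hx⟩
  have := hproj.trace
  rw [LinearMap.trace_eq_sum_inner _ (EuclideanSpace.basisFun (Fin n) ℝ)] at this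
  rw [← this]
  refine Finset.sum_congr rfl fun i _ => ?_
  rw [← real_inner_self_eq_norm_sq, Submodule.inner_starProjection_left_eq_right]
  simp only [ContinuousLinearMap.coe_coe, EuclideanSpace.basisFun_apply]
  rw [K.starProjection_eq_self_iff.mpr (K.starProjection_apply_mem _)]

/-- The vectors of `ℝⁿ` with vanishing coordinate `i`. -/
def zeroAt (i : Fin n) : Submodule ℝ (EuclideanSpace ℝ (Fin n)) :=
  LinearMap.ker ((LinearMap.proj i).comp (WithLp.linearEquiv 2 ℝ (Fin n → ℝ)).toLinearMap)

theorem mem_zeroAt {i : Fin n} {z : EuclideanSpace ℝ (Fin n)} : z ∈ zeroAt i ↔ z i = 0 := by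
  simp [zeroAt]

theorem starProjection_single_eq_zero {K : Submodule ℝ (EuclideanSpace ℝ (Fin n))} {i : Fin n}
    (h : K ≤ zeroAt i) : K.starProjection (EuclideanSpace.single i (1 : ℝ)) = 0 := by
  rw [Submodule.starProjection_apply_eq_zero_iff, Submodule.mem_orthogonal]
  intro z hz
  have := mem_zeroAt.mp (h hz)
  simpa [EuclideanSpace.inner_single_right] using this

theorem norm_starProjection_le_of_le {K V : Submodule ℝ (EuclideanSpace ℝ (Fin n))} (h : K ≤ V)
    (x : EuclideanSpace ℝ (Fin n)) : ‖K.starProjection x‖ ≤ ‖V.starProjection x‖ := by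
  have : K.starProjection x = K.starProjection (V.starProjection x) := by
    rw [← sub_eq_zero, ← map_sub, Submodule.starProjection_apply_eq_zero_iff]
    exact Submodule.orthogonal_le h (V.sub_starProjection_mem_orthogonal x)
  rw [this]
  exact K.norm_starProjection_apply_le _

/-- Either `K` already vanishes at `i` and `P_K eᵢ = 0`, or the dimension drops by at least one
while the subtracted ratio is at most one. The bound for `V` thus serves for every subspace `K`,
whatever its own coherence. -/
theorem finrank_inf_zeroAt_le {K V : Submodule ℝ (EuclideanSpace ℝ (Fin n))} (hKV : K ≤ V)
    {θ : ℝ} (hθ : 0 < θ)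
    (hV : ∀ i, ‖V.starProjection (EuclideanSpace.single i (1 : ℝ))‖ ^ 2 ≤ θ) (i : Fin n) :
    (Module.finrank ℝ (K ⊓ zeroAt i : Submodule ℝ (EuclideanSpace ℝ (Fin n))) : ℝ) ≤
      Module.finrank ℝ K - ‖K.starProjection (EuclideanSpace.single i (1 : ℝ))‖ ^ 2 / θ := by
  by_cases h : K ≤ zeroAt i
  · rw [starProjection_single_eq_zero h, inf_eq_left.mpr h]
    simp
  · have hlt : K ⊓ zeroAt i < K := inf_lt_left.mpr h
    have h1 : (Module.finrank ℝ (K ⊓ zeroAt i : Submodule ℝ (EuclideanSpace ℝ (Fin n))) : ℝ) + 1 ≤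
        Module.finrank ℝ K := by
      exact_mod_cast Submodule.finrank_lt_finrank_of_lt hlt
    have h2 : ‖K.starProjection (EuclideanSpace.single i (1 : ℝ))‖ ^ 2 / θ ≤ 1 := by
      rw [div_le_one hθ]
      exact (pow_le_pow_left₀ (norm_nonneg _) (norm_starProjection_le_of_le hKV _) 2).trans (hV i)
    linarith

theorem sum_finrank_inf_zeroAt_le {K V : Submodule ℝ (EuclideanSpace ℝ (Fin n))} (hKV : K ≤ V)
    {θ : ℝ} (hθ : 0 < θ)
    (hV : ∀ i, ‖V.starProjection (EuclideanSpace.single i (1 : ℝ))‖ ^ 2 ≤ θ) :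
    ∑ i, (Module.finrank ℝ (K ⊓ zeroAt i : Submodule ℝ (EuclideanSpace ℝ (Fin n))) : ℝ) ≤
      Module.finrank ℝ K * (n - 1 / θ) := by
  refine (Finset.sum_le_sum fun i _ => finrank_inf_zeroAt_le hKV hθ hV i).trans_eq ?_
  rw [Finset.sum_sub_distrib, ← Finset.sum_div, sum_norm_sq_starProjection_single]
  simp
  ring

/-- The sum, over all samples of `m` rows, of the dimension of the space of vectors in `K` that
vanish on the sample. -/
theorem sum_finrank_inf_iInf_zeroAt_le {V : Submodule ℝ (EuclideanSpace ℝ (Fin n))}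
    {θ : ℝ} (hθ : 0 < θ)
    (hV : ∀ i, ‖V.starProjection (EuclideanSpace.single i (1 : ℝ))‖ ^ 2 ≤ θ)
    (hn : 0 ≤ n - 1 / θ) (m : ℕ)
    (K : Submodule ℝ (EuclideanSpace ℝ (Fin n))) (hKV : K ≤ V) :
    ∑ ω : Fin m → Fin n, (Module.finrank ℝ
      (K ⊓ ⨅ a, zeroAt (ω a) : Submodule ℝ (EuclideanSpace ℝ (Fin n))) : ℝ) ≤
      Module.finrank ℝ K * (n - 1 / θ) ^ m := by
  induction m generalizing K with
  | zero =>
    rw [Fintype.sum_unique, iInf_of_empty, inf_top_eq, pow_zero, mul_one]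
  | succ m ih =>
    -- Condition on the first row: `K ⊓ zeroAt i` still lies in `V`, so the induction hypothesis
    -- applies with the same `θ`.
    rw [← (Fin.consEquiv fun _ => Fin n).sum_comp, Fintype.sum_prod_type]
    calc _ = ∑ i, ∑ ω : Fin m → Fin n, (Module.finrank ℝ
          ((K ⊓ zeroAt i) ⊓ ⨅ a, zeroAt (ω a) :
            Submodule ℝ (EuclideanSpace ℝ (Fin n))) : ℝ) := by
          refine Finset.sum_congr rfl fun i _ => Finset.sum_congr rfl fun ω _ => ?_
          have : K ⊓ ⨅ a, zeroAt ((Fin.consEquiv fun _ => Fin n) (i, ω) a) =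
              (K ⊓ zeroAt i) ⊓ ⨅ a, zeroAt (ω a) := by
            ext z
            simp [Submodule.mem_iInf, Fin.forall_fin_succ, and_assoc]
          rw [this]
      _ ≤ ∑ i, Module.finrank ℝ (K ⊓ zeroAt i : Submodule ℝ (EuclideanSpace ℝ (Fin n))) *
          (n - 1 / θ) ^ m := Finset.sum_le_sum fun i _ => ih _ (inf_le_left.trans hKV)
      _ = (∑ i, (Module.finrank ℝ
          (K ⊓ zeroAt i : Submodule ℝ (EuclideanSpace ℝ (Fin n))) : ℝ)) * (n - 1 / θ) ^ m := by
          rw [Finset.sum_mul]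
      _ ≤ (Module.finrank ℝ K * (n - 1 / θ)) * (n - 1 / θ) ^ m :=
          mul_le_mul_of_nonneg_right (sum_finrank_inf_zeroAt_le hKV hθ hV) (pow_nonneg hn m)
      _ = _ := by ring

open Classical in
-- Markov's inequality for an integer: each failing sample contributes dimension at least one to the
-- sum.
theorem card_not_injective_sample_le {V : Submodule ℝ (EuclideanSpace ℝ (Fin n))}
    {θ : ℝ} (hθ : 0 < θ)
    (hV : ∀ i, ‖V.starProjection (EuclideanSpace.single i (1 : ℝ))‖ ^ 2 ≤ θ)
    (hn : 0 ≤ n - 1 / θ) (m : ℕ) :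
    ((Finset.univ.filter fun ω : Fin m → Fin n =>
      ¬ ∀ z ∈ V, (∀ a, z (ω a) = 0) → z = 0).card : ℝ) ≤
      Module.finrank ℝ V * (n - 1 / θ) ^ m := by
  refine le_trans ?_ (sum_finrank_inf_iInf_zeroAt_le hθ hV hn m V le_rfl)
  rw [Finset.card_filter, Nat.cast_sum]
  refine Finset.sum_le_sum fun ω _ => ?_
  by_cases h : ∀ z ∈ V, (∀ a, z (ω a) = 0) → z = 0
  · rw [if_neg (not_not.mpr h)]
    simp
  · rw [if_pos h, Nat.cast_le, Nat.one_le_iff_ne_zero, Ne, Submodule.finrank_eq_zero]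
    intro hbot
    refine h fun z hz hza => ?_
    rw [← Submodule.mem_bot ℝ, ← hbot]
    exact ⟨hz, by simpa [Submodule.mem_iInf, mem_zeroAt] using hza⟩

/-- Coordinates of a uniform random function are uniform, as a counting identity cleared of
denominators. -/
theorem card_filter_apply_mem {ι κ : Type} [Fintype ι] [DecidableEq ι] [Fintype κ]
    (P : κ → Prop) [DecidablePred P] (i : ι) :
    (Finset.univ.filter fun f : ι → κ => P (f i)).card * Fintype.card κ =
      (Finset.univ.filter P).card * Fintype.card (ι → κ) := by
  have h1 : (Finset.univ.filter fun f : ι → κ => P (f i)) =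
      Fintype.piFinset (Function.update (fun _ => Finset.univ) i (Finset.univ.filter P)) := by
    ext f
    simp only [Finset.mem_filter, Finset.mem_univ, true_and, Fintype.mem_piFinset]
    refine ⟨fun h a => ?_, fun h => by simpa using h i⟩
    by_cases ha : a = i
    · subst ha; simpa using h
    · simp [Function.update_of_ne ha]
  rw [h1, Fintype.card_piFinset, Fintype.card_fun, ← Finset.card_univ (α := ι),
    ← Finset.mul_prod_erase _ _ (Finset.mem_univ i), Function.update_self,
    Finset.prod_congr rfl (g := fun _ => Fintype.card κ) fun a ha => by
      rw [Function.update_of_ne (Finset.ne_of_mem_erase ha), Finset.card_univ],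
    Finset.prod_const, Finset.card_erase_of_mem (Finset.mem_univ i), mul_assoc, ← pow_succ,
    Nat.sub_add_cancel (Finset.card_pos.mpr ⟨i, Finset.mem_univ i⟩)]

/-- Used twice in the union bound: from all slices to one slice, then from its redraws to one
sample. -/
theorem uniformOn_apply_mem {ι κ : Type} [Fintype ι] [Nonempty ι] [Fintype κ]
    [MeasurableSpace κ] [MeasurableSingletonClass κ] [Nonempty κ]
    (P : κ → Prop) (i : ι) :
    ProbabilityTheory.uniformOn Set.univ {f : ι → κ | P (f i)} =
      ProbabilityTheory.uniformOn Set.univ {a : κ | P a} := by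
  classical
  have h := card_filter_apply_mem P i
  have hc (α : Type) [Fintype α] [MeasurableSpace α] [MeasurableSingletonClass α] (Q : α → Prop) :
      MeasureTheory.Measure.count {a | Q a} = ((Finset.univ.filter Q).card : ℝ≥0∞) := by
    rw [← MeasureTheory.Measure.count_apply_finset]
    congr 1
    ext
    simp
  rw [ProbabilityTheory.uniformOn_univ, ProbabilityTheory.uniformOn_univ, hc, hc,
    ENNReal.div_eq_div_iff (by simp) (by simp) (by simp) (by simp)]
  rw [mul_comm, mul_comm _ ((Finset.univ.filter P).card : ℝ≥0∞)]
  exact_mod_cast h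

end RowSampling

/-! ### Moore-Penrose inverses -/

section Pinv

variable {p q n r : ℕ}

/-- `M X` and `M Y` are both the orthogonal projection onto the range of `M`, and similarly for `X
M` and `Y M`. Uniqueness is what makes the choice in `pinv` computable from any candidate. -/
theorem IsMoorePenrose.unique {M : Matrix (Fin p) (Fin q) ℝ} {X Y : Matrix (Fin q) (Fin p) ℝ}
    (hX : IsMoorePenrose M X) (hY : IsMoorePenrose M Y) : X = Y := by
  obtain ⟨hX1, hX2, hX3, hX4⟩ := hX
  obtain ⟨hY1, hY2, hY3, hY4⟩ := hY
  have h1 : M * X = M * Y := by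
    calc M * X = (M * Y) * (M * X) := by rw [← Matrix.mul_assoc, hY1]
      _ = ((M * X) * (M * Y)).transpose := by rw [Matrix.transpose_mul, hX3, hY3]
      _ = M * Y := by rw [← Matrix.mul_assoc, hX1, hY3]
  have h2 : X * M = Y * M := by
    calc X * M = (X * M) * (Y * M) := by rw [Matrix.mul_assoc, ← Matrix.mul_assoc M, hY1]
      _ = ((Y * M) * (X * M)).transpose := by rw [Matrix.transpose_mul, hX4, hY4]
      _ = Y * M := by rw [Matrix.mul_assoc, ← Matrix.mul_assoc M, hX1, hY4]
  calc X = X * M * X := hX2.symm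
    _ = Y * M * Y := by rw [Matrix.mul_assoc, h1, ← Matrix.mul_assoc, h2]
    _ = Y := hY2

theorem IsMoorePenrose.pinv_eq {M : Matrix (Fin p) (Fin q) ℝ} {X : Matrix (Fin q) (Fin p) ℝ}
    (h : IsMoorePenrose M X) : pinv M = X :=
  (Classical.epsilon_spec (p := IsMoorePenrose M) ⟨X, h⟩ : IsMoorePenrose M (pinv M)).unique h

theorem linearIndependent_col_of_mul_eq_one {M : Matrix (Fin n) (Fin r) ℝ}
    {L : Matrix (Fin r) (Fin n) ℝ} (h : L * M = 1) : LinearIndependent ℝ M.col := by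
  rw [← Matrix.mulVec_injective_iff]
  intro x y hxy
  have := congrArg L.mulVec hxy
  simpa [Matrix.mulVec_mulVec, h] using this

theorem isUnit_transpose_mul_self {A : Matrix (Fin n) (Fin r) ℝ}
    (hA : LinearIndependent ℝ A.col) : IsUnit (A.transpose * A) := by
  have := Matrix.PosDef.conjTranspose_mul_self A (Matrix.mulVec_injective_iff.mpr hA)
  rw [Matrix.conjTranspose_eq_transpose_of_trivial] at this
  exact this.isUnit

theorem isMoorePenrose_of_linearIndependent {A : Matrix (Fin n) (Fin r) ℝ}
    (hA : LinearIndependent ℝ A.col) :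
    IsMoorePenrose A ((A.transpose * A)⁻¹ * A.transpose) := by
  have hdet := (Matrix.isUnit_iff_isUnit_det _).mp (isUnit_transpose_mul_self hA)
  have h1 : (A.transpose * A)⁻¹ * A.transpose * A = 1 := by
    rw [Matrix.mul_assoc, Matrix.nonsing_inv_mul _ hdet]
  refine ⟨by rw [Matrix.mul_assoc, h1, Matrix.mul_one], by rw [h1, Matrix.one_mul], ?_,
    by rw [h1, Matrix.transpose_one]⟩
  rw [Matrix.transpose_mul, Matrix.transpose_mul, Matrix.transpose_transpose,
    Matrix.transpose_nonsing_inv, Matrix.transpose_mul, Matrix.transpose_transpose,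
    Matrix.mul_assoc]

theorem pinv_mul_self {A : Matrix (Fin n) (Fin r) ℝ} (hA : LinearIndependent ℝ A.col) :
    pinv A * A = 1 := by
  have hdet := (Matrix.isUnit_iff_isUnit_det _).mp (isUnit_transpose_mul_self hA)
  rw [(isMoorePenrose_of_linearIndependent hA).pinv_eq, Matrix.mul_assoc,
    Matrix.nonsing_inv_mul _ hdet]

theorem transpose_mul_pinv {A : Matrix (Fin n) (Fin r) ℝ} (hA : LinearIndependent ℝ A.col) :
    (A * pinv A).transpose = A * pinv A := by
  rw [(isMoorePenrose_of_linearIndependent hA).pinv_eq]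
  exact (isMoorePenrose_of_linearIndependent hA).2.2.1

theorem diagonal_mul_diagonal_inv {e : Fin r → ℝ} (he : ∀ l, e l ≠ 0) :
    Matrix.diagonal e * Matrix.diagonal e⁻¹ = 1 := by
  rw [Matrix.diagonal_mul_diagonal, ← Matrix.diagonal_one]
  congr 1
  ext l
  simp [he l]

theorem diagonal_inv_mul_diagonal {e : Fin r → ℝ} (he : ∀ l, e l ≠ 0) :
    Matrix.diagonal e⁻¹ * Matrix.diagonal e = 1 :=
  mul_eq_one_comm.mp (diagonal_mul_diagonal_inv he)

/-- Reverse-order law for a rank factorization: the two products with the candidate collapse to the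
symmetric projections `A A†` and `B B†`. -/
theorem pinv_mul_diagonal_mul_transpose {A B : Matrix (Fin n) (Fin r) ℝ}
    (hA : LinearIndependent ℝ A.col) (hB : LinearIndependent ℝ B.col) {e : Fin r → ℝ}
    (he : ∀ l, e l ≠ 0) :
    pinv (A * Matrix.diagonal e * B.transpose) =
      (pinv B).transpose * Matrix.diagonal e⁻¹ * pinv A := by
  have hA1 := pinv_mul_self hA
  have hB1 : B.transpose * (pinv B).transpose = 1 := by
    rw [← Matrix.transpose_mul, pinv_mul_self hB, Matrix.transpose_one]
  have h1 := diagonal_mul_diagonal_inv he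
  have h2 := diagonal_inv_mul_diagonal he
  have hMX : A * Matrix.diagonal e * B.transpose *
      ((pinv B).transpose * Matrix.diagonal e⁻¹ * pinv A) = A * pinv A := by
    calc _ = A * (Matrix.diagonal e * (B.transpose * (pinv B).transpose) *
          Matrix.diagonal e⁻¹) * pinv A := by simp only [Matrix.mul_assoc]
      _ = _ := by rw [hB1, Matrix.mul_one, h1, Matrix.mul_one]
  have hXM : (pinv B).transpose * Matrix.diagonal e⁻¹ * pinv A *
      (A * Matrix.diagonal e * B.transpose) = B * pinv B := by
    calc _ = (pinv B).transpose * (Matrix.diagonal e⁻¹ * (pinv A * A) *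
          Matrix.diagonal e) * B.transpose := by simp only [Matrix.mul_assoc]
      _ = (B * pinv B).transpose := by
        rw [hA1, Matrix.mul_one, h2, Matrix.mul_one, Matrix.transpose_mul]
      _ = _ := transpose_mul_pinv hB
  refine IsMoorePenrose.pinv_eq ⟨?_, ?_, ?_, ?_⟩
  · rw [hMX]
    calc _ = A * (pinv A * A) * Matrix.diagonal e * B.transpose := by
          simp only [Matrix.mul_assoc]
      _ = _ := by rw [hA1, Matrix.mul_one]
  · rw [Matrix.mul_assoc _ _ ((pinv B).transpose * _ * _), hMX]
    calc _ = (pinv B).transpose * Matrix.diagonal e⁻¹ * (pinv A * A) * pinv A := by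
          simp only [Matrix.mul_assoc]
      _ = _ := by rw [hA1, Matrix.mul_one]
  · rw [hMX, transpose_mul_pinv hA]
  · rw [hXM, transpose_mul_pinv hB]

end Pinv

/-! ### Simultaneous diagonalization -/

section Diagonalization

variable {n r : ℕ} {A B : Matrix (Fin n) (Fin r) ℝ}

theorem mul_diagonal_mul_transpose_apply (f : Fin r → ℝ) (i j : Fin n) :
    (A * Matrix.diagonal f * B.transpose) i j = ∑ l, A i l * B j l * f l := by
  rw [Matrix.mul_apply]
  refine Finset.sum_congr rfl fun l _ => ?_
  rw [Matrix.mul_diagonal, Matrix.transpose_apply]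
  ring

/-- The columns of an eigenvector matrix of `A Λ A†` with simple nonzero spectrum are those of
`A`, up to order and scaling: `Â = A G` where `G` is invertible and transports diagonal matrices to
diagonal matrices. -/
theorem IsEigenDecomposition.exists_eq_mul (hA : LinearIndependent ℝ A.col) {lam : Fin r → ℝ}
    (h0 : ∀ l, lam l ≠ 0) (hinj : Function.Injective lam) {A' : Matrix (Fin n) (Fin r) ℝ}
    {lam' : Fin r → ℝ} (h : IsEigenDecomposition (A * Matrix.diagonal lam * pinv A) A' lam') :
    ∃ (G H : Matrix (Fin r) (Fin r) ℝ) (π : Fin r → Fin r), G * H = 1 ∧ A' = A * G ∧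
      pinv A' * A = H ∧
      ∀ f : Fin r → ℝ, Matrix.diagonal f * G = G * Matrix.diagonal (f ∘ π) := by
  obtain ⟨hA', hW⟩ := h
  set W := A * Matrix.diagonal lam * pinv A with hWdef
  have hWA : W * A = A * Matrix.diagonal lam := by
    rw [hWdef, Matrix.mul_assoc, pinv_mul_self hA, Matrix.mul_one]
  have hWA' : W * A' = A' * Matrix.diagonal lam' := by
    rw [hW, Matrix.mul_assoc, pinv_mul_self hA', Matrix.mul_one]
  -- Read off from `A = W A Λ⁻¹` with `W` replaced by its other decomposition, so that `A` factors
  -- through `A'`.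
  set H := Matrix.diagonal lam' * pinv A' * A * Matrix.diagonal lam⁻¹ with hH
  have hAH : A = A' * H := by
    calc A = W * A * Matrix.diagonal lam⁻¹ := by
          rw [hWA, Matrix.mul_assoc, diagonal_mul_diagonal_inv h0, Matrix.mul_one]
      _ = A' * H := by rw [hH, hW]; simp only [Matrix.mul_assoc]
  set G := pinv A * A' with hG
  have hGH : G * H = 1 := by rw [hG, Matrix.mul_assoc, ← hAH, pinv_mul_self hA]
  have hAG : A' = A * G := by
    conv_rhs => rw [hAH, Matrix.mul_assoc, mul_eq_one_comm.mp hGH, Matrix.mul_one]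
  have hLG : Matrix.diagonal lam * G = G * Matrix.diagonal lam' := by
    calc Matrix.diagonal lam * G = pinv A * (A * Matrix.diagonal lam) * G := by
          rw [← Matrix.mul_assoc (pinv A) A, pinv_mul_self hA, Matrix.one_mul]
      _ = pinv A * (W * A') := by rw [← hWA, hAG]; simp only [Matrix.mul_assoc]
      _ = G * Matrix.diagonal lam' := by rw [hWA', hG, Matrix.mul_assoc]
  -- A nonzero entry `G i l` forces `lam i = lam' l`; as `lam` is injective, each column of `G` has
  -- a single nonzero entry, in row `π l`.
  have hentry : ∀ i l, lam i * G i l = G i l * lam' l := fun i l => by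
    have := congrFun (congrFun hLG i) l
    rwa [Matrix.diagonal_mul, Matrix.mul_diagonal] at this
  have hcol : ∀ l, ∃ i, G i l ≠ 0 := by
    intro l
    by_contra! hl
    have : (H * G) l l = 1 := by rw [mul_eq_one_comm.mp hGH, Matrix.one_apply_eq]
    simp [Matrix.mul_apply, hl] at this
  choose π hπ using hcol
  refine ⟨G, H, π, hGH, hAG, ?_, fun f => ?_⟩
  · conv_lhs => rw [hAH, ← Matrix.mul_assoc, pinv_mul_self hA', Matrix.one_mul]
  · ext i l
    rw [Matrix.diagonal_mul, Matrix.mul_diagonal, Function.comp]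
    by_cases hi : G i l = 0
    · simp [hi]
    · have h1 : lam i = lam' l := mul_right_cancel₀ hi (by rw [hentry, mul_comm])
      have h2 : lam (π l) = lam' l := mul_right_cancel₀ (hπ l) (by rw [hentry, mul_comm])
      rw [hinj (h1.trans h2.symm), mul_comm]

/-- With `A' = A G` and `B'ᵀ = G⁻¹ diag(d) Bᵀ`, insert `G G⁻¹` into `A diag(f/d) diag(d) Bᵀ` and
move `diag(f/d)` through `G`. Since `f` is arbitrary, slices outside `S` are covered. -/
theorem exists_factors_of_diagonalization (hA : LinearIndependent ℝ A.col)
    (hB : LinearIndependent ℝ B.col) {d e : Fin r → ℝ} (hd : ∀ l, d l ≠ 0) (he : ∀ l, e l ≠ 0)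
    (hde : ∀ l l', l ≠ l' → d l * e l' ≠ d l' * e l) {A' B' : Matrix (Fin n) (Fin r) ℝ}
    (hA' : A' = eigenvectorMatrix r (A * Matrix.diagonal d * B.transpose *
      pinv (A * Matrix.diagonal e * B.transpose)))
    (hB' : B' = (pinv A' * (A * Matrix.diagonal d * B.transpose)).transpose) :
    LinearIndependent ℝ A'.col ∧ LinearIndependent ℝ B'.col ∧
      ∀ f : Fin r → ℝ, ∃ c : Fin r → ℝ,
        A * Matrix.diagonal f * B.transpose = A' * Matrix.diagonal c * B'.transpose := by
  have hW : A * Matrix.diagonal d * B.transpose * pinv (A * Matrix.diagonal e * B.transpose) =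
      A * Matrix.diagonal (d / e) * pinv A := by
    have hB1 : B.transpose * (pinv B).transpose = 1 := by
      rw [← Matrix.transpose_mul, pinv_mul_self hB, Matrix.transpose_one]
    rw [pinv_mul_diagonal_mul_transpose hA hB he]
    calc _ = A * (Matrix.diagonal d * (B.transpose * (pinv B).transpose) *
          Matrix.diagonal e⁻¹) * pinv A := by simp only [Matrix.mul_assoc]
      _ = _ := by
        rw [hB1, Matrix.mul_one, Matrix.diagonal_mul_diagonal]
        rfl
  rw [hW] at hA'
  -- `A` itself is an eigenvector matrix, so the choice in `eigenvectorMatrix` is a genuine one.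
  have hspec : ∃ lam', IsEigenDecomposition (A * Matrix.diagonal (d / e) * pinv A) A' lam' := by
    rw [hA']
    exact Classical.epsilon_spec
      (p := fun X => ∃ lam', IsEigenDecomposition (A * Matrix.diagonal (d / e) * pinv A) X lam')
      ⟨A, d / e, hA, rfl⟩
  obtain ⟨lam', hlam'⟩ := hspec
  obtain ⟨G, H, π, hGH, hAG, hH, hf⟩ := hlam'.exists_eq_mul hA
    (fun l => div_ne_zero (hd l) (he l)) (fun l l' hll => by
      by_contra hne
      refine hde l l' hne ?_
      rwa [div_eq_div_iff (he l) (he l')] at hll)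
  have hBH : B'.transpose = H * Matrix.diagonal d * B.transpose := by
    rw [hB', Matrix.transpose_transpose, ← hH]
    simp only [Matrix.mul_assoc]
  refine ⟨hlam'.1, linearIndependent_col_of_mul_eq_one
    (L := G.transpose * Matrix.diagonal d⁻¹ * pinv B) ?_, fun f => ⟨(f / d) ∘ π, ?_⟩⟩
  · have : B' = B * Matrix.diagonal d * H.transpose := by
      rw [← Matrix.transpose_transpose B', hBH]
      simp [Matrix.transpose_mul, Matrix.mul_assoc]
    calc _ = G.transpose * (Matrix.diagonal d⁻¹ * (pinv B * B) * Matrix.diagonal d) *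
          H.transpose := by rw [this]; simp only [Matrix.mul_assoc]
      _ = (H * G).transpose := by
        rw [pinv_mul_self hB, Matrix.mul_one, diagonal_inv_mul_diagonal hd, Matrix.mul_one,
          Matrix.transpose_mul]
      _ = 1 := by rw [mul_eq_one_comm.mp hGH, Matrix.transpose_one]
  · calc _ = A * (Matrix.diagonal (f / d) * Matrix.diagonal d) * B.transpose := by
          rw [Matrix.diagonal_mul_diagonal]
          congr 3
          ext l
          simp [hd l]
      _ = A * (Matrix.diagonal (f / d) * (G * H) * Matrix.diagonal d) * B.transpose := by
          rw [hGH, Matrix.mul_one]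
      _ = A * ((Matrix.diagonal (f / d) * G) * H * Matrix.diagonal d) * B.transpose := by
          simp only [Matrix.mul_assoc]
      _ = _ := by
          rw [hf, hBH, hAG]
          simp only [Matrix.mul_assoc]

/-- The product with `c` is `A diag(c) Bᵀ` written as a vector, and one-sided inverses of `A` and
`Bᵀ` recover `diag(c)`. -/
theorem eq_zero_of_khatriRao_mulVec_eq_zero (hA : LinearIndependent ℝ A.col)
    (hB : LinearIndependent ℝ B.col) {c : Fin r → ℝ}
    (h : ∀ p, (khatriRao A B).mulVec c p = 0) : c = 0 := by
  have h0 : A * Matrix.diagonal c * B.transpose = 0 := by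
    ext i j
    rw [mul_diagonal_mul_transpose_apply]
    exact h (i, j)
  have hB1 : B.transpose * (pinv B).transpose = 1 := by
    rw [← Matrix.transpose_mul, pinv_mul_self hB, Matrix.transpose_one]
  have : Matrix.diagonal c = 0 := by
    calc Matrix.diagonal c =
          (pinv A * A) * Matrix.diagonal c * (B.transpose * (pinv B).transpose) := by
          rw [pinv_mul_self hA, hB1, Matrix.one_mul, Matrix.mul_one]
      _ = pinv A * (A * Matrix.diagonal c * B.transpose) * (pinv B).transpose := by
          simp only [Matrix.mul_assoc]
      _ = 0 := by rw [h0, Matrix.mul_zero, Matrix.zero_mul]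
  rwa [Matrix.diagonal_eq_zero] at this

end Diagonalization

/-! ### Censored least squares -/

/-- The system is consistent, so the minimum is zero; every minimizer then solves it exactly, and
the trivial kernel leaves only one. -/
theorem censoredLeastSquares_eq {κ : Type} {r : ℕ} {M : Matrix κ (Fin r) ℝ} {K : Finset κ}
    (hK : ∀ c : Fin r → ℝ, (∀ p ∈ K, M.mulVec c p = 0) → c = 0) {t : κ → ℝ} {c : Fin r → ℝ}
    (hc : ∀ p ∈ K, M.mulVec c p = t p) : censoredLeastSquares M K t = c := by
  have hc0 : ∑ p ∈ K, (M.mulVec c p - t p) ^ 2 = 0 :=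
    Finset.sum_eq_zero fun p hp => by rw [hc p hp, sub_self]; ring
  have hspec := Classical.epsilon_spec (p := fun c : Fin r → ℝ => ∀ c' : Fin r → ℝ,
    ∑ p ∈ K, (M.mulVec c p - t p) ^ 2 ≤ ∑ p ∈ K, (M.mulVec c' p - t p) ^ 2)
    ⟨c, fun c' => by rw [hc0]; positivity⟩
  have hle := (hspec c).trans_eq hc0
  have h0 := (Finset.sum_eq_zero_iff_of_nonneg fun p _ => sq_nonneg _).mp
    (le_antisymm hle (Finset.sum_nonneg fun p _ => sq_nonneg _))
  rw [← sub_eq_zero]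
  refine hK _ fun p hp => ?_
  rw [Matrix.mulVec_sub, Pi.sub_apply, hc p hp]
  exact pow_eq_zero_iff two_ne_zero |>.mp (h0 p hp)

/-! ### QR factorization with column pivoting -/

section PivotedQR

variable {κ : Type} {r N : ℕ}

/-- Greedy pivoting: a chain of subspaces, each spanned by the previous one and a vector of the
family with maximal residual. -/
theorem exists_greedy_pivots [Finite κ] [Nonempty κ] {E : Type} [NormedAddCommGroup E]
    [InnerProductSpace ℝ E] [FiniteDimensional ℝ E] (m : κ → E) :
    ∃ (p : ℕ → κ) (V : ℕ → Submodule ℝ E), V 0 = ⊥ ∧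
      (∀ k, V (k + 1) = V k ⊔ Submodule.span ℝ {m (p k)}) ∧
      ∀ k j, ‖m j - (V k).starProjection (m j)‖ ≤ ‖m (p k) - (V k).starProjection (m (p k))‖ := by
  have hmax (V : Submodule ℝ E) := Finite.exists_max fun j => ‖m j - V.starProjection (m j)‖
  choose pick hpick using hmax
  let V : ℕ → Submodule ℝ E := fun k =>
    Nat.rec ⊥ (fun _ V => V ⊔ Submodule.span ℝ {m (pick V)}) k
  exact ⟨fun k => pick (V k), V, rfl, fun k => rfl, fun k j => hpick (V k) j⟩

/-- Gram–Schmidt on greedy pivots: `q k` is the normalized residual of pivot `k`. A zero maximal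
residual before step `r` would put the whole family in a space of dimension below `r`, against `hm`.
The pivot inequality is Bessel's inequality for the residual, as `q i` is orthogonal to `V k` for `k
≤ i`. -/
theorem exists_greedy_orthonormal [Finite κ] [Nonempty κ] (m : κ → EuclideanSpace ℝ (Fin r))
    (hm : ∀ z : EuclideanSpace ℝ (Fin r), (∀ j, inner ℝ (m j) z = 0) → z = 0) :
    ∃ (p : Fin r → κ) (q : Fin r → EuclideanSpace ℝ (Fin r)), Orthonormal ℝ q ∧
      Function.Injective p ∧ (∀ i j, j < i → inner ℝ (q i) (m (p j)) = 0) ∧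
      ∀ k j, ∑ i ∈ Finset.Ici k, (inner ℝ (q i) (m j) : ℝ) ^ 2 ≤ inner ℝ (q k) (m (p k)) ^ 2 := by
  obtain ⟨p, V, hV0, hVs, hp⟩ := exists_greedy_pivots m
  have hmono : Monotone V := monotone_nat_of_le_succ fun k => by rw [hVs]; exact le_sup_left
  have hmem : ∀ k, m (p k) ∈ V (k + 1) := fun k => by
    rw [hVs]
    exact Submodule.mem_sup_right (Submodule.mem_span_singleton_self _)
  have hdim : ∀ k, Module.finrank ℝ (V k) ≤ k := by
    intro k
    induction k with
    | zero => simp [hV0]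
    | succ k ih =>
      rw [hVs]
      have h1 := Submodule.finrank_add_le_finrank_add_finrank (V k)
        (Submodule.span ℝ {m (p k)})
      have h2 : Module.finrank ℝ (Submodule.span ℝ {m (p k)}) ≤ 1 :=
        (finrank_span_le_card ({m (p k)} : Set _)).trans (by simp)
      omega
  obtain ⟨ρ, hρdef⟩ : ∃ ρ : ℕ → EuclideanSpace ℝ (Fin r),
      ∀ k, ρ k = m (p k) - (V k).starProjection (m (p k)) := ⟨_, fun _ => rfl⟩
  have hρorth : ∀ k, ρ k ∈ (V k)ᗮ := fun k => by
    rw [hρdef]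
    exact (V k).sub_starProjection_mem_orthogonal _
  have hρmem : ∀ k, ρ k ∈ V (k + 1) := fun k => by
    rw [hρdef]
    exact (V (k + 1)).sub_mem (hmem k) (hmono k.le_succ ((V k).starProjection_apply_mem _))
  have hρ : ∀ k < r, ρ k ≠ 0 := by
    intro k hk h0
    have hall : ∀ j, m j ∈ V k := fun j => by
      have := hp k j
      rw [← hρdef, h0, norm_zero, norm_le_zero_iff, sub_eq_zero] at this
      rw [this]
      exact (V k).starProjection_apply_mem _
    have hne : (V k)ᗮ ≠ ⊥ := by
      intro hbot
      have := Submodule.finrank_add_finrank_orthogonal (V k)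
      rw [hbot, finrank_bot, finrank_euclideanSpace_fin] at this
      have := hdim k
      omega
    obtain ⟨z, hz, hz0⟩ := Submodule.exists_mem_ne_zero_of_ne_bot hne
    exact hz0 (hm z fun j => (Submodule.mem_orthogonal _ _).mp hz _ (hall j))
  obtain ⟨q, hqdef⟩ : ∃ q : Fin r → EuclideanSpace ℝ (Fin r),
      ∀ k, q k = ‖ρ k‖⁻¹ • ρ k := ⟨_, fun _ => rfl⟩
  have hqorth : ∀ k : Fin r, q k ∈ (V k)ᗮ := fun k => by
    rw [hqdef]
    exact Submodule.smul_mem _ _ (hρorth k)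
  have hqmem : ∀ k : Fin r, q k ∈ V (k + 1) := fun k => by
    rw [hqdef]
    exact Submodule.smul_mem _ _ (hρmem k)
  have hqV : ∀ (i : Fin r) (k : ℕ), k ≤ i → ∀ x ∈ V k, inner ℝ (q i) x = 0 :=
    fun i k hki x hx => by
      rw [real_inner_comm]
      exact (Submodule.mem_orthogonal _ _).mp (hqorth i) _ (hmono hki hx)
  have hq : Orthonormal ℝ q := by
    refine ⟨fun k => ?_, fun i k hik => ?_⟩
    · rw [hqdef, norm_smul, norm_inv, norm_norm,
        inv_mul_cancel₀ (norm_ne_zero_iff.mpr (hρ k k.2))]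
    · rcases lt_or_gt_of_ne hik with h | h
      · rw [real_inner_comm]
        exact hqV k _ (Nat.succ_le_of_lt h) _ (hqmem i)
      · exact hqV i _ (Nat.succ_le_of_lt h) _ (hqmem k)
  have hne : ∀ j k, j < k → k < r → p j ≠ p k := by
    intro j k hjk hk h
    refine hρ k hk ?_
    have : m (p k) ∈ V k := h ▸ hmono (Nat.succ_le_of_lt hjk) (hmem j)
    rw [hρdef, (V k).starProjection_eq_self_iff.mpr this, sub_self]
  have hres : ∀ (k i : Fin r) (j : κ), k ≤ i →
      inner ℝ (q i) (m j) = inner ℝ (q i) (m j - (V k).starProjection (m j)) := by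
    intro k i j hki
    rw [inner_sub_right, hqV i k hki _ ((V k).starProjection_apply_mem _), sub_zero]
  refine ⟨fun k => p k, q, hq, ?_, ?_, ?_⟩
  · intro j k hjk
    rcases lt_trichotomy j k with h | h | h
    · exact absurd hjk (hne _ _ h k.2)
    · exact h
    · exact absurd hjk.symm (hne _ _ h j.2)
  · exact fun i j hji => hqV i _ (Nat.succ_le_of_lt hji) _ (hmem j)
  · intro k j
    calc ∑ i ∈ Finset.Ici k, (inner ℝ (q i) (m j) : ℝ) ^ 2
        = ∑ i ∈ Finset.Ici k, ‖inner ℝ (q i) (m j - (V k).starProjection (m j))‖ ^ 2 :=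
          Finset.sum_congr rfl fun i hi => by
            rw [hres k i j (Finset.mem_Ici.mp hi), Real.norm_eq_abs, sq_abs]
      _ ≤ ‖m j - (V k).starProjection (m j)‖ ^ 2 := hq.sum_inner_products_le _
      _ ≤ ‖ρ k‖ ^ 2 := by
          rw [hρdef]
          exact pow_le_pow_left₀ (norm_nonneg _) (hp k _) 2
      _ = inner ℝ (q k) (m (p k)) ^ 2 := by
          rw [hres k k _ le_rfl, ← hρdef, hqdef, real_inner_smul_left,
            real_inner_self_eq_norm_sq, sq ‖ρ k‖, ← mul_assoc,
            inv_mul_cancel₀ (norm_ne_zero_iff.mpr (hρ k k.2)), one_mul, sq]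

theorem exists_isPivotedQR [Fintype κ] [Nonempty κ] (e : Fin N ≃ κ) (M : Matrix (Fin r) κ ℝ)
    (hM : ∀ c : Fin r → ℝ, (∀ p, M.transpose.mulVec c p = 0) → c = 0) :
    ∃ σ Q R, IsPivotedQR (N := N) M σ Q R := by
  classical
  obtain ⟨p, q, hq, hinj, htri, hpiv⟩ := exists_greedy_orthonormal
    (fun j => WithLp.toLp 2 (M.col j)) fun z hz => by
      have : z.ofLp = 0 := hM _ fun j => by
        simpa [PiLp.inner_apply, Matrix.mulVec, dotProduct, mul_comm] using hz j
      ext i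
      exact congrFun this i
  have hcard : Fintype.card (Fin N) = (Finset.univ : Finset κ).card := by
    rw [Finset.card_univ]
    exact Fintype.card_congr e
  -- The pivoting rule constrains only the first `r` places, so the other columns follow in any
  -- order and the default value is never used.
  obtain ⟨σ', hσ'⟩ := Finset.exists_equiv_extend_of_card_eq hcard
    (s := Finset.univ.filter fun j : Fin N => (j : ℕ) < r)
    (f := fun j => if h : (j : ℕ) < r then p ⟨j, h⟩ else Classical.arbitrary κ)
    (Finset.subset_univ _) (by
      intro j hj k hk hjk
      have hj' : (j : ℕ) < r := by simpa using hj
      have hk' : (k : ℕ) < r := by simpa using hk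
      simp only [dif_pos hj', dif_pos hk'] at hjk
      simpa [Fin.ext_iff] using hinj hjk)
  let σ : Fin N ≃ κ := σ'.trans (Equiv.subtypeUnivEquiv Finset.mem_univ)
  have hσ : ∀ (j : Fin N) (h : (j : ℕ) < r), σ j = p ⟨j, h⟩ := fun j hj =>
    (hσ' j (by simpa using hj)).trans (dif_pos hj)
  let Q : Matrix (Fin r) (Fin r) ℝ := Matrix.of fun a i => q i a
  have hQ : Q.transpose * Q = 1 := by
    ext i k
    rw [Matrix.one_apply, ← (orthonormal_iff_ite.mp hq) i k, Matrix.mul_apply]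
    simp [Q, PiLp.inner_apply, mul_comm]
  let R : Matrix (Fin r) (Fin N) ℝ := Q.transpose * M.submatrix id σ
  have hR : ∀ i j, R i j = inner ℝ (q i) (WithLp.toLp 2 (M.col (σ j))) := fun i j => by
    change (Q.transpose * M.submatrix id σ) i j = _
    rw [Matrix.mul_apply]
    simp [Q, PiLp.inner_apply, mul_comm]
  refine ⟨σ, Q, R, (Matrix.mem_orthogonalGroup_iff' _ _).mpr hQ, ?_, ?_, ?_⟩
  · rw [← Matrix.mul_assoc, mul_eq_one_comm.mp hQ, Matrix.one_mul]
  · intro i j hji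
    rw [hR, hσ j (hji.trans i.2)]
    exact htri i _ hji
  · intro k d j hdk _
    simp only [hR]
    refine (hpiv k (σ j)).trans_eq ?_
    rw [hσ d (hdk ▸ k.2)]
    simp only [hdk]

/-- The rows of `Mᵀ` at the first `r` pivots of a matrix `M` of full row rank are independent. -/
theorem IsPivotedQR.eq_zero_of_pivots {M : Matrix (Fin r) κ ℝ} {σ : Fin N ≃ κ}
    {Q : Matrix (Fin r) (Fin r) ℝ} {R : Matrix (Fin r) (Fin N) ℝ} (h : IsPivotedQR M σ Q R)
    (hr : r ≤ N) (hM : ∀ c : Fin r → ℝ, (∀ p, M.transpose.mulVec c p = 0) → c = 0)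
    {c : Fin r → ℝ} (hc : ∀ j : Fin N, (j : ℕ) < r → M.transpose.mulVec c (σ j) = 0) :
    c = 0 := by
  obtain ⟨hQ, hMQR, htri, hpiv⟩ := h
  have hQ1 : Q.transpose * Q = 1 := (Matrix.mem_orthogonalGroup_iff' _ _).mp hQ
  have hQ2 : Q * Q.transpose = 1 := mul_eq_one_comm.mp hQ1
  have hval : ∀ (c : Fin r → ℝ) j, M.transpose.mulVec c (σ j) =
      R.transpose.mulVec (Q.transpose.mulVec c) j := by
    intro c j
    rw [Matrix.mulVec_mulVec, ← Matrix.transpose_mul, ← hMQR]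
    rfl
  -- By maximality a zero pivot kills the whole row `k` of `R`, and then the `k`-th column of `Q`
  -- lies in the kernel of `Mᵀ`.
  have hdiag : ∀ k : Fin r, R k (Fin.castLE hr k) ≠ 0 := by
    intro k hk
    have hrow : ∀ j, R k j = 0 := by
      intro j
      rcases lt_or_ge (j : ℕ) k with hj | hj
      · exact htri k j hj
      · have h1 := hpiv k (Fin.castLE hr k) j rfl (Fin.le_def.mpr hj)
        rw [hk] at h1
        have h2 : R k j ^ 2 ≤ ∑ i ∈ Finset.Ici k, R i j ^ 2 :=
          Finset.single_le_sum (f := fun i => R i j ^ 2) (fun i _ => sq_nonneg _)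
            (Finset.mem_Ici.mpr le_rfl)
        have h3 : R k j ^ 2 = 0 := le_antisymm (by linarith) (sq_nonneg _)
        exact pow_eq_zero_iff two_ne_zero |>.mp h3
    have h0 : Q.mulVec (Pi.single k 1) = 0 := hM _ fun p => by
      obtain ⟨j, rfl⟩ := σ.surjective p
      rw [hval, Matrix.mulVec_mulVec _ Q.transpose, hQ1, Matrix.one_mulVec,
        Matrix.mulVec_single_one]
      exact hrow j
    have h1 := congrArg Q.transpose.mulVec h0
    rw [Matrix.mulVec_mulVec, hQ1, Matrix.one_mulVec, Matrix.mulVec_zero] at h1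
    simpa using congrFun h1 k
  -- Forward substitution: the first `r` rows of `Rᵀ` are lower triangular with nonzero diagonal.
  have hy : ∀ N, ∀ k : Fin r, (k : ℕ) = N → Q.transpose.mulVec c k = 0 := by
    intro N
    induction N using Nat.strong_induction_on with
    | _ N ih =>
      intro k hkN
      have := hc (Fin.castLE hr k) k.2
      rw [hval, Matrix.mulVec, dotProduct, Finset.sum_eq_single k] at this
      · exact (mul_eq_zero.mp this).resolve_left (hdiag k)
      · intro i _ hik
        rcases lt_or_gt_of_ne hik with h | h
        · rw [ih i (hkN ▸ h) i rfl, mul_zero]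
        · rw [Matrix.transpose_apply, htri i _ h, zero_mul]
      · simp
  have : Q.transpose.mulVec c = 0 := funext fun k => hy k k rfl
  calc c = Q.mulVec (Q.transpose.mulVec c) := by rw [Matrix.mulVec_mulVec, hQ2, Matrix.one_mulVec]
    _ = 0 := by rw [this, Matrix.mulVec_zero]

end PivotedQR

/-! ### Fibers selected by the pivots -/

section FiberSample

variable {n r : ℕ} {A B : Matrix (Fin n) (Fin r) ℝ}

theorem card_fiberSample_le : (fiberSample A B).card ≤ r := by
  rw [fiberSample, Finset.card_map]
  calc _ ≤ (Finset.range r).card :=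
        Finset.card_le_card_of_injOn (fun q : Fin (n * n) => (q : ℕ))
          (fun q hq => by simpa using hq) (fun a _ b _ h => Fin.ext h)
    _ = r := Finset.card_range r

theorem eq_zero_of_khatriRao_fiberSample (hr : 0 < r) (hrn : r ≤ n)
    (hA : LinearIndependent ℝ A.col) (hB : LinearIndependent ℝ B.col) {c : Fin r → ℝ}
    (hc : ∀ p ∈ fiberSample A B, (khatriRao A B).mulVec c p = 0) : c = 0 := by
  have hM : ∀ c : Fin r → ℝ,
      (∀ p, (khatriRao A B).transpose.transpose.mulVec c p = 0) → c = 0 := fun c h =>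
    eq_zero_of_khatriRao_mulVec_eq_zero hA hB h
  have : Nonempty (Fin n × Fin n) := ⟨(⟨0, by omega⟩, ⟨0, by omega⟩)⟩
  have hspec : ∃ Q R, IsPivotedQR (khatriRao A B).transpose
      (pivotOrder (khatriRao A B).transpose) Q R :=
    Classical.epsilon_spec
      (p := fun σ : Fin (n * n) ≃ Fin n × Fin n =>
        ∃ Q R, IsPivotedQR (khatriRao A B).transpose σ Q R)
      (exists_isPivotedQR finProdFinEquiv.symm _ hM)
  obtain ⟨Q, R, hQR⟩ := hspec
  refine hQR.eq_zero_of_pivots (hrn.trans (Nat.le_mul_self n)) hM fun j hj => hc _ ?_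
  rw [fiberSample, Finset.mem_map]
  exact ⟨j, by simpa using hj, rfl⟩

end FiberSample

/-! ### Generic directions -/

section Generic

open MeasureTheory

variable {n r : ℕ} {S : Finset (Fin n)}

/-- The surface measure of a set is a multiple of the volume of the cone over it, and here the cone
lies in a proper subspace. -/
theorem uniformSphere_hyperplane {w : EuclideanSpace ℝ S} (hw : w ≠ 0) :
    ∀ᵐ u : UnitSphere S ∂uniformSphere S, inner ℝ w (u : EuclideanSpace ℝ S) ≠ 0 := by
  suffices h : ∀ᵐ u : UnitSphere S ∂(volume : Measure (EuclideanSpace ℝ S)).toSphere,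
      inner ℝ w (u : EuclideanSpace ℝ S) ≠ 0 from
    ProbabilityTheory.cond_absolutelyContinuous.ae_le h
  rw [ae_iff]
  simp only [not_not]
  have hs : MeasurableSet {u : UnitSphere S | inner ℝ w (u : EuclideanSpace ℝ S) = 0} :=
    measurableSet_eq_fun (by fun_prop) measurable_const
  rw [Measure.toSphere_apply' _ hs]
  refine mul_eq_zero_of_right _ (measure_mono_null (t := ((Submodule.span ℝ {w})ᗮ :
    Submodule ℝ (EuclideanSpace ℝ S))) ?_ (Measure.addHaar_submodule _ _ ?_))
  · rintro _ ⟨a, _, _, ⟨u, hu, rfl⟩, rfl⟩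
    rw [SetLike.mem_coe, Submodule.mem_orthogonal_singleton_iff_inner_right]
    change inner ℝ w (a • (u : EuclideanSpace ℝ S)) = 0
    rw [inner_smul_right, show inner ℝ w (u : EuclideanSpace ℝ S) = 0 from hu, mul_zero]
  · intro htop
    have : w ∈ (Submodule.span ℝ {w})ᗮ := htop ▸ Submodule.mem_top
    rw [Submodule.mem_orthogonal_singleton_iff_inner_right, inner_self_eq_zero] at this
    exact hw this

/-- For pairwise independent vectors, almost all directions `u`, `v` give nonzero inner products
with pairwise different ratios. -/
theorem ae_generic_directions (hS : S.Nonempty) {c : Fin r → EuclideanSpace ℝ S}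
    (hc0 : ∀ l, c l ≠ 0)
    (hc : ∀ l l', l ≠ l' → ∀ a b : ℝ, a • c l - b • c l' = 0 → a = 0) :
    ∀ᵐ z : UnitSphere S × UnitSphere S ∂(uniformSphere S).prod (uniformSphere S),
      (∀ l, inner ℝ (c l) (z.1 : EuclideanSpace ℝ S) ≠ 0) ∧
      (∀ l, inner ℝ (c l) (z.2 : EuclideanSpace ℝ S) ≠ 0) ∧
      ∀ l l', l ≠ l' →
        inner ℝ (c l) (z.1 : EuclideanSpace ℝ S) * inner ℝ (c l') (z.2 : EuclideanSpace ℝ S) ≠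
        inner ℝ (c l') (z.1 : EuclideanSpace ℝ S) * inner ℝ (c l) (z.2 : EuclideanSpace ℝ S) := by
  have := isProbabilityMeasure_uniformSphere hS
  have h1 : ∀ᵐ u : UnitSphere S ∂uniformSphere S,
      ∀ l, inner ℝ (c l) (u : EuclideanSpace ℝ S) ≠ 0 :=
    ae_all_iff.mpr fun l => uniformSphere_hyperplane (hc0 l)
  refine (Measure.quasiMeasurePreserving_fst.ae h1).and
    ((Measure.quasiMeasurePreserving_snd.ae h1).and ?_)
  rw [ae_all_iff]
  intro l
  rw [ae_all_iff]
  intro l'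
  by_cases hl : l = l'
  · simp [hl]
  · simp only [ne_eq, hl, not_false_eq_true, forall_const]
    rw [Measure.ae_prod_iff_ae_ae]
    · filter_upwards [h1] with u hu
      -- For fixed `u`, equality of the two products says that `v` is orthogonal to this vector,
      -- which pairwise independence makes nonzero; Fubini finishes.
      have hw : inner ℝ (c l') (u : EuclideanSpace ℝ S) • c l -
          inner ℝ (c l) (u : EuclideanSpace ℝ S) • c l' ≠ 0 := fun h => hu l' (hc l l' hl _ _ h)
      filter_upwards [uniformSphere_hyperplane hw] with v hv h
      refine hv ?_
      rw [inner_sub_left, real_inner_smul_left, real_inner_smul_left, h, sub_self]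
    · exact (measurableSet_eq_fun (by fun_prop) (by fun_prop)).compl

end Generic

/-! ### Kruskal rank and coherence -/

section TensorClass

variable {n r : ℕ}

/-- The supremum is attained, and any two columns extend to a set of exactly that many independent
columns. In particular the tensor class is empty for `r = 1`. -/
theorem two_le_kruskalRank {κ : Type} {M : Matrix κ (Fin r) ℝ} (h : 2 ≤ kruskalRank M) :
    2 ≤ r ∧ ∀ l l', l ≠ l' → LinearIndependent ℝ ![M.col l, M.col l'] := by
  have hmem : kruskalRank M ≤ r ∧ ∀ J : Finset (Fin r), J.card = kruskalRank M →
      LinearIndependent ℝ (fun l : J => M.col (l : Fin r)) :=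
    Nat.sSup_mem (s := {k : ℕ | k ≤ r ∧ ∀ J : Finset (Fin r), J.card = k →
      LinearIndependent ℝ (fun l : J => M.col (l : Fin r))})
      ⟨0, Nat.zero_le _, fun J hJ => by
        obtain rfl := Finset.card_eq_zero.mp hJ
        exact linearIndependent_empty_type⟩
      ⟨r, fun k hk => hk.1⟩
  refine ⟨h.trans hmem.1, fun l l' hl => ?_⟩
  obtain ⟨J, hJ, hJc⟩ := Finset.exists_superset_card_eq (s := {l, l'}) (n := kruskalRank M)
    (by rwa [Finset.card_pair hl]) (by simpa using hmem.1)
  have hlJ : l ∈ J := hJ (by simp)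
  have hlJ' : l' ∈ J := hJ (by simp)
  have := (hmem.2 J hJc).comp ![⟨l, hlJ⟩, ⟨l', hlJ'⟩] (by
    intro i j hij
    fin_cases i <;> fin_cases j <;> simp_all [eq_comm])
  convert this using 1
  ext i
  fin_cases i <;> rfl

theorem toLp_mulVec_mem_columnSpace (A : Matrix (Fin n) (Fin r) ℝ) (c : Fin r → ℝ) :
    WithLp.toLp 2 (A.mulVec c) ∈ columnSpace A := by
  have : WithLp.toLp 2 (A.mulVec c) = ∑ l, c l • WithLp.toLp 2 (A.col l) := by
    ext i
    simp [Matrix.mulVec, dotProduct, mul_comm]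
  rw [this]
  exact Submodule.sum_mem _ fun l _ =>
    Submodule.smul_mem _ _ (Submodule.subset_span (Set.mem_range_self l))

theorem finrank_columnSpace {A : Matrix (Fin n) (Fin r) ℝ} (hA : LinearIndependent ℝ A.col) :
    Module.finrank ℝ (columnSpace A) = r := by
  have : LinearIndependent ℝ (fun l => WithLp.toLp 2 (A.col l)) :=
    hA.map' (WithLp.linearEquiv 2 ℝ (Fin n → ℝ)).symm.toLinearMap (LinearEquiv.ker _)
  rw [columnSpace, finrank_span_eq_card this, Fintype.card_fin]

theorem norm_starProjection_columnSpace_le {A : Matrix (Fin n) (Fin r) ℝ}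
    (hA : LinearIndependent ℝ A.col) (hr : 0 < r) (hn : 0 < n) {μ₀ : ℝ}
    (hμ : coherence (columnSpace A) ≤ μ₀) (i : Fin n) :
    ‖(columnSpace A).starProjection (EuclideanSpace.single i (1 : ℝ))‖ ^ 2 ≤ μ₀ * r / n := by
  rw [coherence, finrank_columnSpace hA] at hμ
  have hr' : (0 : ℝ) < r := by exact_mod_cast hr
  have hn' : (0 : ℝ) < n := by exact_mod_cast hn
  have h1 := le_ciSup (f := fun i : Fin n =>
    ‖(columnSpace A).starProjection (EuclideanSpace.single i (1 : ℝ))‖ ^ 2)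
    (Set.finite_range _).bddAbove i
  refine h1.trans ?_
  rw [le_div_iff₀ hn']
  rw [div_mul_eq_mul_div, div_le_iff₀ hr'] at hμ
  linarith

theorem cpTensor_slice (A B C : Matrix (Fin n) (Fin r) ℝ) (i j k : Fin n) :
    cpTensor A B C (i, j, k) = (A * Matrix.diagonal (C k) * B.transpose) i j :=
  (mul_diagonal_mul_transpose_apply _ _ _).symm

theorem cpTensor_slice_col_mem (A B C : Matrix (Fin n) (Fin r) ℝ) (k t : Fin n) :
    (fun i => cpTensor A B C (i, t, k)) ∈ LinearMap.range A.mulVecLin := by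
  refine ⟨fun l => B t l * C k l, ?_⟩
  ext i
  simp [cpTensor, Matrix.mulVec, dotProduct, mul_assoc]

theorem finrank_range_mulVecLin_le (A : Matrix (Fin n) (Fin r) ℝ) :
    Module.finrank ℝ (LinearMap.range A.mulVecLin) ≤ r := by
  simpa using LinearMap.finrank_range_le A.mulVecLin

end TensorClass

/-! ### Tensor Sandwich -/

section Sandwich

variable {n r m : ℕ} {S : Finset (Fin n)}

/-- Holds for every seed, even when completion or diagonalization fails: the rank of `A` limits the
full columns and the pivot count limits the fibers. -/
theorem card_observed_sandwichRun_le (A B C : Matrix (Fin n) (Fin r) ℝ)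
    (ω : SandwichSeed S m) :
    ((sandwichRun r S ω).observed (cpTensor A B C)).card ≤
      S.card * (n * m + r * n) + r * n := by
  rw [sandwichRun, Sampler.observed_bind]
  refine (Finset.card_union_le _ _).trans (add_le_add ?_ ?_)
  · refine (Sampler.card_observed_forEach_le (N := n * m + r * n) _ _ _ fun k => ?_).trans ?_
    · rw [Sampler.observed_reindex]
      refine Finset.card_image_le.trans ((card_observed_completeMatrix_le (ω.1 k)
        (V := LinearMap.range A.mulVecLin) fun t => cpTensor_slice_col_mem A B C k t).trans ?_)
      gcongr
      exact finrank_range_mulVecLin_le A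
    · simp
  · extract_lets Tu Tv A' B' K
    rw [Sampler.observed_bind]
    simp only [Sampler.observed, Finset.union_empty]
    refine (Sampler.card_observed_observeList_le _ _).trans ?_
    rw [List.length_map, Finset.length_toList, Finset.card_product, Finset.card_univ,
      Fintype.card_fin]
    exact Nat.mul_le_mul_right _ card_fiberSample_le

theorem sum_smul_slice (A B C : Matrix (Fin n) (Fin r) ℝ) (u : EuclideanSpace ℝ S) :
    ∑ k : S, u k • (A * Matrix.diagonal (C k) * B.transpose) =
      A * Matrix.diagonal (fun l => inner ℝ (WithLp.toLp 2 fun k : S => C k l) u) *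
        B.transpose := by
  ext i j
  rw [mul_diagonal_mul_transpose_apply, Matrix.sum_apply]
  simp only [Matrix.smul_apply, mul_diagonal_mul_transpose_apply, smul_eq_mul, Finset.mul_sum,
    PiLp.inner_apply]
  rw [Finset.sum_comm]
  refine Finset.sum_congr rfl fun l _ => Finset.sum_congr rfl fun k _ => ?_
  simp
  ring

/-- The deterministic half of correctness: the seed enters only through injective row samples and
generic directions. -/
theorem output_sandwichRun (hr : 0 < r) (hrn : r ≤ n) {A B C : Matrix (Fin n) (Fin r) ℝ}
    (hA : LinearIndependent ℝ A.col) (hB : LinearIndependent ℝ B.col) {ω : SandwichSeed S m}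
    (hω : ∀ (k : S) (j : Fin (n + 1)), (j : ℕ) ≤ r →
      ∀ z ∈ LinearMap.range A.mulVecLin, (∀ a, z (ω.1 k j a) = 0) → z = 0)
    (hu : ∀ l, inner ℝ (WithLp.toLp 2 fun k : S => C k l) (ω.2.1 : EuclideanSpace ℝ S) ≠ 0)
    (hv : ∀ l, inner ℝ (WithLp.toLp 2 fun k : S => C k l) (ω.2.2 : EuclideanSpace ℝ S) ≠ 0)
    (huv : ∀ l l', l ≠ l' →
      inner ℝ (WithLp.toLp 2 fun k : S => C k l) (ω.2.1 : EuclideanSpace ℝ S) *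
      inner ℝ (WithLp.toLp 2 fun k : S => C k l') (ω.2.2 : EuclideanSpace ℝ S) ≠
      inner ℝ (WithLp.toLp 2 fun k : S => C k l') (ω.2.1 : EuclideanSpace ℝ S) *
      inner ℝ (WithLp.toLp 2 fun k : S => C k l) (ω.2.2 : EuclideanSpace ℝ S)) :
    (sandwichRun r S ω).output (cpTensor A B C) = cpTensor A B C := by
  have hX : ∀ k : S, (Sampler.forEach (fun k : S => (completeMatrix (ω.1 k)).reindex
      fun p => (p.1, p.2, (k : Fin n))) Finset.univ.toList).output (cpTensor A B C) k =
      A * Matrix.diagonal (C k) * B.transpose := by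
    intro k
    rw [Sampler.output_forEach_of_mem _ _ (by simp), Sampler.output_reindex,
      output_completeMatrix (V := LinearMap.range A.mulVecLin)
        (fun t => cpTensor_slice_col_mem A B C k t)
        fun j hj => hω k j (hj.trans (finrank_range_mulVecLin_le A))]
    ext i t
    exact cpTensor_slice A B C i t k
  rw [sandwichRun, Sampler.output_bind]
  extract_lets Tu Tv A' B' K
  rw [Sampler.output_bind]
  simp only [Sampler.output]
  have hTu : Tu = A * Matrix.diagonal (fun l => inner ℝ (WithLp.toLp 2 fun k : S => C k l)
      (ω.2.1 : EuclideanSpace ℝ S)) * B.transpose := by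
    rw [← sum_smul_slice]
    exact Finset.sum_congr rfl fun k _ => by rw [hX]
  have hTv : Tv = A * Matrix.diagonal (fun l => inner ℝ (WithLp.toLp 2 fun k : S => C k l)
      (ω.2.2 : EuclideanSpace ℝ S)) * B.transpose := by
    rw [← sum_smul_slice]
    exact Finset.sum_congr rfl fun k _ => by rw [hX]
  obtain ⟨hA', hB', hf⟩ := exists_factors_of_diagonalization hA hB hu hv huv (A' := A') (B' := B')
    (by rw [← hTu, ← hTv]) (by rw [← hTu])
  choose c hc using fun k => hf (C k)
  have hC : (fun k => censoredLeastSquares (khatriRao A' B') K fun p =>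
      (Sampler.observeList ((K ×ˢ Finset.univ).toList.map
        fun q : (Fin n × Fin n) × Fin n => (q.1.1, q.1.2, q.2))).output (cpTensor A B C)
        (p.1, p.2, k)) = c := by
    ext1 k
    refine censoredLeastSquares_eq
      (fun c hc => eq_zero_of_khatriRao_fiberSample hr hrn hA' hB' hc) fun p hp => ?_
    rw [Sampler.output_observeList_of_mem _ (by
      rw [List.mem_map]
      exact ⟨(p, k), by simpa using hp, rfl⟩), cpTensor_slice, hc,
      mul_diagonal_mul_transpose_apply]
    rfl
  rw [hC]
  funext p
  obtain ⟨i, j, k⟩ := p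
  rw [cpTensor_slice A B C, hc]
  exact cpTensor_slice A' B' c i j k

end Sandwich

/-! ### Failure probability and sample size -/

section Probability

open MeasureTheory

variable {n r m : ℕ}

/-- Take `θ = μ₀r/n`, so the mean dimension shrinks by `1 - 1/(μ₀r)` per row, and use `1 - x ≤
exp(-x)`. -/
theorem uniformOn_not_injective_sample_le {A : Matrix (Fin n) (Fin r) ℝ}
    (hA : LinearIndependent ℝ A.col) (hr : 0 < r) (hn : 0 < n) {μ₀ : ℝ} (hμ₀ : 1 ≤ μ₀)
    (hμ : coherence (columnSpace A) ≤ μ₀) (m : ℕ) :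
    ProbabilityTheory.uniformOn Set.univ {a : Fin m → Fin n |
      ¬ ∀ z ∈ LinearMap.range A.mulVecLin, (∀ t, z (a t) = 0) → z = 0} ≤
      ENNReal.ofReal (r * Real.exp (-(m / (μ₀ * r)))) := by
  classical
  have hr' : (1 : ℝ) ≤ r := by exact_mod_cast hr
  have hn' : (0 : ℝ) < n := by exact_mod_cast hn
  have hμr : 1 ≤ μ₀ * r := one_le_mul_of_one_le_of_one_le hμ₀ hr'
  have hθ : 0 < μ₀ * r / n := div_pos (by linarith) hn'
  have hfac : (n : ℝ) - 1 / (μ₀ * r / n) = n * (1 - 1 / (μ₀ * r)) := by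
    field_simp
  have hq : 0 ≤ 1 - 1 / (μ₀ * r) := by
    rw [sub_nonneg, div_le_one (by linarith)]
    exact hμr
  have hcard := card_not_injective_sample_le hθ
    (norm_starProjection_columnSpace_le hA hr hn hμ) (by rw [hfac]; positivity) m
  rw [finrank_columnSpace hA, hfac, mul_pow] at hcard
  have hsub : {a : Fin m → Fin n |
      ¬ ∀ z ∈ LinearMap.range A.mulVecLin, (∀ t, z (a t) = 0) → z = 0} ⊆
      ((Finset.univ.filter fun a : Fin m → Fin n =>
        ¬ ∀ z ∈ columnSpace A, (∀ t, z (a t) = 0) → z = 0 : Finset _) : Set _) := by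
    intro a ha
    rw [Finset.mem_coe, Finset.mem_filter]
    refine ⟨Finset.mem_univ _, fun h => ha ?_⟩
    rintro _ ⟨c, rfl⟩ hz
    exact congrArg WithLp.ofLp (h _ (toLp_mulVec_mem_columnSpace A c) hz)
  refine (measure_mono hsub).trans ?_
  rw [ProbabilityTheory.uniformOn_univ, Measure.count_apply_finset]
  have : Nonempty (Fin n) := ⟨⟨0, hn⟩⟩
  refine ENNReal.div_le_of_le_mul ?_
  rw [← ENNReal.ofReal_natCast, ← ENNReal.ofReal_natCast (Fintype.card _),
    ← ENNReal.ofReal_mul (by positivity)]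
  refine ENNReal.ofReal_le_ofReal (hcard.trans ?_)
  rw [Fintype.card_fun, Fintype.card_fin, Fintype.card_fin, Nat.cast_pow, mul_assoc,
    mul_comm (Real.exp _)]
  have hexp : (1 - 1 / (μ₀ * r)) ^ m ≤ Real.exp (-(m / (μ₀ * r))) := by
    calc (1 - 1 / (μ₀ * r)) ^ m ≤ Real.exp (-(1 / (μ₀ * r))) ^ m :=
          pow_le_pow_left₀ hq (Real.one_sub_le_exp_neg _) m
      _ = Real.exp (-(m / (μ₀ * r))) := by
          rw [← Real.exp_nat_mul]
          congr 1
          ring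
  gcongr

theorem uniformOn_exists_not_injective_le {A : Matrix (Fin n) (Fin r) ℝ}
    (hA : LinearIndependent ℝ A.col) (hr : 0 < r) (hrn : r ≤ n) {μ₀ : ℝ} (hμ₀ : 1 ≤ μ₀)
    (hμ : coherence (columnSpace A) ≤ μ₀) {S : Finset (Fin n)} (hS : S.Nonempty) (m : ℕ) :
    ProbabilityTheory.uniformOn Set.univ {ω : S → RowDraws n m |
      ¬ ∀ (k : S) (j : Fin (n + 1)), (j : ℕ) ≤ r →
        ∀ z ∈ LinearMap.range A.mulVecLin, (∀ a, z (ω k j a) = 0) → z = 0} ≤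
      ENNReal.ofReal (S.card * ((r + 1) * (r * Real.exp (-(m / (μ₀ * r)))))) := by
  have hn : 0 < n := hr.trans_le hrn
  have : Nonempty (Fin n) := ⟨⟨0, hn⟩⟩
  have : Nonempty S := hS.to_subtype
  let P : (Fin m → Fin n) → Prop := fun a =>
    ¬ ∀ z ∈ LinearMap.range A.mulVecLin, (∀ t, z (a t) = 0) → z = 0
  have hsub : {ω : S → RowDraws n m | ¬ ∀ (k : S) (j : Fin (n + 1)), (j : ℕ) ≤ r →
        ∀ z ∈ LinearMap.range A.mulVecLin, (∀ a, z (ω k j a) = 0) → z = 0} ⊆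
      ⋃ k : S, ⋃ j : Fin (r + 1), {ω | P (ω k (Fin.castLE (by omega) j))} := by
    intro ω hω
    by_contra hnot
    refine hω fun k j hj => ?_
    by_contra hP
    exact hnot (Set.mem_iUnion.mpr ⟨k, Set.mem_iUnion.mpr ⟨⟨j, by omega⟩, hP⟩⟩)
  calc _ ≤ _ := measure_mono hsub
    _ ≤ ∑ k : S, ∑ j : Fin (r + 1), ProbabilityTheory.uniformOn Set.univ
          {ω : S → RowDraws n m | P (ω k (Fin.castLE (by omega) j))} :=
        (measure_iUnion_fintype_le _ _).trans
          (Finset.sum_le_sum fun k _ => measure_iUnion_fintype_le _ _)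
    _ ≤ ∑ k : S, ∑ j : Fin (r + 1), ENNReal.ofReal (r * Real.exp (-(m / (μ₀ * r)))) := by
        refine Finset.sum_le_sum fun k _ => Finset.sum_le_sum fun j _ => ?_
        rw [uniformOn_apply_mem (fun g : RowDraws n m => P (g (Fin.castLE (by omega) j))) k,
          uniformOn_apply_mem P]
        exact uniformOn_not_injective_sample_le hA hr hn hμ₀ hμ m
    _ = _ := by
        rw [Finset.sum_const, Finset.sum_const, Finset.card_univ, Finset.card_univ,
          Fintype.card_fin, Fintype.card_coe, nsmul_eq_mul, nsmul_eq_mul,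
          ← Nat.cast_succ, ← ENNReal.ofReal_natCast, ← ENNReal.ofReal_natCast,
          ← ENNReal.ofReal_mul (by positivity), ← ENNReal.ofReal_mul (by positivity)]

theorem sandwichLaw_output_ne_le {A B C : Matrix (Fin n) (Fin r) ℝ}
    (hA : LinearIndependent ℝ A.col) (hB : LinearIndependent ℝ B.col) (hr : 0 < r)
    (hrn : r ≤ n) {μ₀ : ℝ} (hμ₀ : 1 ≤ μ₀) (hμ : coherence (columnSpace A) ≤ μ₀)
    {S : Finset (Fin n)} (hS : S.Nonempty)
    (hC : 2 ≤ kruskalRank (C.submatrix (fun k : S => (k : Fin n)) id)) (m : ℕ) :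
    sandwichLaw S m {ω | (sandwichRun r S ω).output (cpTensor A B C) ≠ cpTensor A B C} ≤
      ENNReal.ofReal (S.card * ((r + 1) * (r * Real.exp (-(m / (μ₀ * r)))))) := by
  have := isProbabilityMeasure_uniformSphere hS
  have : Nonempty (Fin n) := ⟨hS.choose⟩
  have : IsProbabilityMeasure
      (ProbabilityTheory.uniformOn (Set.univ : Set (S → RowDraws n m))) :=
    ProbabilityTheory.isProbabilityMeasure_uniformOn Set.finite_univ Set.univ_nonempty
  let c : Fin r → EuclideanSpace ℝ S := fun l => WithLp.toLp 2 fun k : S => C k l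
  obtain ⟨hr2, hpair⟩ := two_le_kruskalRank hC
  have hcpair : ∀ l l', l ≠ l' → ∀ a b : ℝ, a • c l - b • c l' = 0 → a = 0 := by
    intro l l' hl a b hab
    refine (LinearIndependent.pair_iff.mp (hpair l l' hl) a (-b) ?_).1
    have := congrArg WithLp.ofLp hab
    rw [neg_smul, ← sub_eq_add_neg]
    exact this
  have hc0 : ∀ l, c l ≠ 0 := by
    intro l hl
    have : Nontrivial (Fin r) := Fin.nontrivial_iff_two_le.mpr hr2
    obtain ⟨l', hl'⟩ := exists_ne l
    exact one_ne_zero (hcpair l l' hl'.symm 1 0 (by simp [hl]))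
  have hgen := ae_generic_directions hS hc0 hcpair
  -- Only outer measure is used from here on, so the failure event need not be shown measurable.
  obtain ⟨good, hnull, hgood⟩ := Filter.eventually_iff_exists_mem.mp hgen
  let bad₁ := {ω : S → RowDraws n m | ¬ ∀ (k : S) (j : Fin (n + 1)), (j : ℕ) ≤ r →
        ∀ z ∈ LinearMap.range A.mulVecLin, (∀ a, z (ω k j a) = 0) → z = 0}
  refine (measure_mono (t := bad₁ ×ˢ Set.univ ∪ Set.univ ×ˢ goodᶜ) fun ω hω => ?_).trans
    ((measure_union_le _ _).trans ?_)
  · by_contra hnot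
    simp only [Set.mem_union, Set.mem_prod, Set.mem_univ, and_true, true_and, not_or] at hnot
    obtain ⟨hu, hv, huv⟩ := hgood _ (Set.notMem_compl_iff.mp hnot.2)
    exact hω (output_sandwichRun hr hrn hA hB (not_not.mp hnot.1) hu hv huv)
  · rw [sandwichLaw, Measure.prod_prod, Measure.prod_prod, mem_ae_iff.mp hnull, mul_zero, add_zero,
      measure_univ, mul_one]
    exact uniformOn_exists_not_injective_le hA hr hrn hμ₀ hμ hS m

end Probability

/-- Here `r²/δ > 4 > e`. -/
theorem one_le_log_sq_div {r : ℕ} (hr : 2 ≤ r) {δ : ℝ} (hδ : 0 < δ) (hδ1 : δ < 1) :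
    1 ≤ Real.log ((r : ℝ) ^ 2 / δ) := by
  have hr' : (2 : ℝ) ≤ r := by exact_mod_cast hr
  rw [Real.le_log_iff_exp_le (by positivity), le_div_iff₀ hδ]
  have := Real.exp_one_lt_d9
  nlinarith [Real.exp_pos 1]

/-- The row sample size. -/
def rowSampleSize (r : ℕ) (μ₀ δ : ℝ) : ℕ := ⌈2 * μ₀ * r * Real.log ((r : ℝ) ^ 2 / δ)⌉₊

/-- The factor 2 in the sample size squares `δ/r²`, leaving `(r + 1)δ²/r³ ≤ δ`; a factor 1 would
leave `(1 + 1/r)δ`, which is too large. -/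
theorem failure_bound_rowSampleSize {r : ℕ} (hr : 2 ≤ r) {μ₀ δ : ℝ} (hμ₀ : 1 ≤ μ₀) (hδ : 0 < δ)
    (hδ1 : δ < 1) :
    ((r : ℝ) + 1) * (r * Real.exp (-(rowSampleSize r μ₀ δ / (μ₀ * r)))) ≤ δ := by
  have hr' : (2 : ℝ) ≤ r := by exact_mod_cast hr
  have hμr : 0 < μ₀ * r := by positivity
  have hm : 2 * Real.log ((r : ℝ) ^ 2 / δ) ≤ rowSampleSize r μ₀ δ / (μ₀ * r) := by
    rw [le_div_iff₀ hμr]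
    refine le_trans (le_of_eq ?_) (Nat.le_ceil _)
    ring
  have hexp : Real.exp (-(rowSampleSize r μ₀ δ / (μ₀ * r))) ≤ (δ / r ^ 2) ^ 2 := by
    calc _ ≤ Real.exp (-(2 * Real.log ((r : ℝ) ^ 2 / δ))) :=
          Real.exp_le_exp.mpr (neg_le_neg hm)
      _ = (δ / r ^ 2) ^ 2 := by
          rw [← mul_neg, ← Real.log_inv, inv_div, mul_comm, Real.exp_mul,
            Real.exp_log (by positivity)]
          norm_cast
  calc _ ≤ ((r : ℝ) + 1) * (r * (δ / r ^ 2) ^ 2) := by gcongr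
    _ = ((r : ℝ) + 1) * δ ^ 2 / r ^ 3 := by field_simp
    _ ≤ δ := by
      rw [div_le_iff₀ (by positivity)]
      have h1 : (r : ℝ) + 1 ≤ r ^ 3 := by nlinarith [sq_nonneg ((r : ℝ) - 2)]
      have h2 : δ ^ 2 ≤ δ := by nlinarith
      calc ((r : ℝ) + 1) * δ ^ 2 ≤ r ^ 3 * δ := by gcongr
        _ = _ := mul_comm _ _

/-- The constant is `5 = 3 + 1 + 1`: row samples including the rounding, full columns, and fibers.
The second logarithm is slack, bought with `L ≥ 1`. -/
theorem observation_bound_rowSampleSize {n r s : ℕ} (hr : 2 ≤ r) (hs : 0 < s) {μ₀ δ : ℝ}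
    (hμ₀ : 1 ≤ μ₀) (hδ : 0 < δ) (hδ1 : δ < 1) :
    (s : ℝ) * (n * rowSampleSize r μ₀ δ + r * n) + r * n ≤
      5 * s * μ₀ * n * r * Real.log ((r : ℝ) ^ 2 / δ) ^ 2 := by
  have hL := one_le_log_sq_div hr hδ hδ1
  set L := Real.log ((r : ℝ) ^ 2 / δ) with hLdef
  have hr' : (1 : ℝ) ≤ r := by exact_mod_cast (by omega : 1 ≤ r)
  have hs' : (1 : ℝ) ≤ s := by exact_mod_cast hs
  have hL2 : L ≤ L ^ 2 := by nlinarith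
  have hL1 : 1 ≤ L ^ 2 := hL.trans hL2
  have hμL : 1 ≤ μ₀ * L ^ 2 := one_le_mul_of_one_le_of_one_le hμ₀ hL1
  have hm : (rowSampleSize r μ₀ δ : ℝ) ≤ 3 * (μ₀ * r * L ^ 2) := by
    have h1 : (rowSampleSize r μ₀ δ : ℝ) < 2 * μ₀ * r * L + 1 :=
      Nat.ceil_lt_add_one (by positivity)
    have h2 : μ₀ * r * L ≤ μ₀ * r * L ^ 2 := by gcongr
    have h3 : 1 ≤ μ₀ * r * L ^ 2 :=
      one_le_mul_of_one_le_of_one_le (one_le_mul_of_one_le_of_one_le hμ₀ hr') hL1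
    linarith
  have hrn : (r : ℝ) * n ≤ r * n * (μ₀ * L ^ 2) := le_mul_of_one_le_right (by positivity) hμL
  calc _ ≤ (s : ℝ) * (n * (3 * (μ₀ * r * L ^ 2)) + r * n * (μ₀ * L ^ 2)) +
        s * (r * n * (μ₀ * L ^ 2)) := by
        refine add_le_add ?_ (hrn.trans (le_mul_of_one_le_left (by positivity) hs'))
        gcongr
    _ = _ := by ring

end

theorem theorem1 :
    ∃ C₁ : ℝ, 0 < C₁ ∧
      ∀ (n r s : ℕ), 0 < r → r ≤ n → 0 < s → s ≤ n →
      ∀ μ₀ : ℝ, 1 ≤ μ₀ → μ₀ ≤ (n : ℝ) / (r : ℝ) →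
      ∀ δ : ℝ, 0 < δ →
      ∀ (S : Finset (Fin n)) (hS : S.Nonempty), S.card = s →
      ∃ 𝒜 : AdaptiveAlgorithm (Fin n × Fin n × Fin n) (Tensor n),
        (δ < 1 → ∃ m : ℕ, 𝒜 = tensorSandwich r S hS m) ∧
        ∀ T ∈ tensorClass n r μ₀ s,
          (∀ ω : 𝒜.Seed, (((𝒜.run ω).observed T).card : ℝ) ≤
            C₁ * s * μ₀ * n * r * Real.log ((r : ℝ) ^ 2 / δ) ^ 2) ∧
          𝒜.law {ω | (𝒜.run ω).output T ≠ T} ≤ ENNReal.ofReal (s * δ) := by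
  refine ⟨5, by norm_num, fun n r s hr hrn hs _ μ₀ hμ₀ _ δ hδ S hS hSs => ?_⟩
  rcases lt_or_ge δ 1 with hδ1 | hδ1
  · refine ⟨tensorSandwich r S hS (rowSampleSize r μ₀ δ), fun _ => ⟨_, rfl⟩, ?_⟩
    rintro T ⟨A, B, C, rfl, hA, hB, hμ, hC⟩
    have hCS := hC S hSs
    have hr2 := (two_le_kruskalRank hCS).1
    refine ⟨fun ω => ?_, ?_⟩
    · refine le_trans ?_ (observation_bound_rowSampleSize hr2 hs hμ₀ hδ hδ1)
      rw [← hSs]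
      exact_mod_cast card_observed_sandwichRun_le A B C ω
    · refine (sandwichLaw_output_ne_le hA hB hr hrn hμ₀ hμ hS hCS _).trans
        (ENNReal.ofReal_le_ofReal ?_)
      rw [hSs]
      exact mul_le_mul_of_nonneg_left (failure_bound_rowSampleSize hr2 hμ₀ hδ hδ1)
        (Nat.cast_nonneg s)
  -- For `δ ≥ 1` the allowed failure probability `sδ` is at least one, so observing nothing and
  -- returning zero suffices.
  · refine ⟨{ Seed := Unit, law := MeasureTheory.Measure.dirac (), run := fun _ => .done 0 },
      fun h => absurd h (not_lt.mpr hδ1), fun T _ => ⟨fun ω => ?_, ?_⟩⟩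
    · simp only [Sampler.observed, Finset.card_empty, Nat.cast_zero]
      positivity
    · refine MeasureTheory.prob_le_one.trans ?_
      rw [ENNReal.one_le_ofReal]
      exact one_le_mul_of_one_le_of_one_le (by exact_mod_cast hs) hδ1
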